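/- Let $F$ be a non-Archimedean local field with ring of integers $O$, maximal ideal $\mathfrak p=\varpi O$ and residue field $\mathbb F=O/\mathfrak p$, and put $O_i=O/\mathfrak p^i$. Let $\tau$ be a continuous unitary character of the additive group $F$ with $\{x\in F : \tau(xy)=1\ \forall y\in O\}=O$. Let $l\ge 2$, $r=2l-1$, $l'=l-1$, $G_i=GL_n(O_i)$, and for $0<i<r$ let $K_i$ be the kernel of the reduction $G_r\to G_i$. Let $\beta\in M_n(O)$, $\overline\beta=\beta\bmod\mathfrak p\in M_n(\mathbb F)$ and $\beta_r=\beta\bmod\mathfrak p^r$. Put $\mathcal C=(O_r[\beta_r])^\times\subset G_r$, let $\psi_\beta$ be the character $1_n+\varpi^lX \bmod\mathfrak p^r\mapsto\tau(\varpi^{-l'}\operatorname{tr}(X\beta))$ of $K_l$, and let $K_{l-1}(\mathbb F[\overline\beta])$ be the inverse image of $\mathbb F[\overline\beta]\subset M_n(\mathbb F)$ under the homomorphism $K_{l-1}\to M_n(\mathbb F)$, $1_n+\varpi^{l-1}X\bmod\mathfrak p^r\mapsto X\bmod\mathfrak p$. Let $Y(\psi_\beta)$ be the set of homomorphisms $\psi:K_{l-1}(\mathbb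 F[\overline\beta])\to\mathbb C^\times$ with $\psi|_{K_l}=\psi_\beta$. Assume that $\overline\beta$ is regular (its characteristic polynomial equals its minimal polynomial). For each $\psi\in Y(\psi_\beta)$ there is, up to equivalence, a unique irreducible complex representation $(\pi_\psi,H_\psi)$ of $K_{l-1}$ whose restriction to $K_{l-1}(\mathbb F[\overline\beta])$ contains $\psi$. For every $\varepsilon\in\mathcal C$ there is $U(\varepsilon)\in GL_{\mathbb C}(H_\psi)$ with $\pi_\psi(\varepsilon k\varepsilon^{-1})=U(\varepsilon)\pi_\psi(k)U(\varepsilon)^{-1}$ for all $k\in K_{l-1}$. The relation $U(\varepsilon)U(\eta)=c_U(\varepsilon,\eta)\,U(\varepsilon\eta)$ $(\varepsilon,\eta\in\mathcal C)$ defines a 2-cocycle $c_U$, whose class $c(\psi)\in H^2(\mathcal C,\mathbb C^\times)$ (trivial action) does not depend on the choices. Theorem. Suppose that $\overline\beta$ is regular and split (all eigenvalues of $\overline\beta$ lie in $\mathbb F$), with Jordan canonical form $\operatorname{diag}(J_{n_1}(a_1),\dots,J_{n_f}(a_f))$, where $a_1,\dots,a_f\in\mathbb F$ are the distinct eigenvalues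 of $\overline\beta$. If $n_i\le 4$ for all $i$ and $\operatorname{char}\mathbb F>7$, then $c(\psi)$ is trivial for all $\psi\in Y(\psi_\beta)$. -/

import Mathlib

open ValuativeRel

noncomputable section

namespace RegularChar

/-! ### Second cohomology of a group with coefficients in an abelian group with trivial action -/

section Cohomology

variable (G M : Type*) [Group G] [CommGroup M]

/-- The group `Z²(G, M)` of 2-cocycles, where `G` acts trivially on `M`. -/
def Z2 : Subgroup (G → G → M) where
  carrier := {c | ∀ x y z, c y z * c x (y * z) = c (x * y) z * c x y}
  one_mem' := by intro x y z; simp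
  mul_mem' := by
    intro a b ha hb x y z
    have h := congrArg₂ (· * ·) (ha x y z) (hb x y z)
    simp only [Pi.mul_apply] at h ⊢
    calc _ = a y z * a x (y * z) * (b y z * b x (y * z)) := by ac_rfl
      _ = _ := h
      _ = _ := by ac_rfl
  inv_mem' := by
    intro a ha x y z
    have h := congrArg (·⁻¹) (ha x y z)
    simpa [mul_comm] using h

/-- The group `B²(G, M)` of 2-coboundaries, where `G` acts trivially on `M`. -/
def B2 : Subgroup (G → G → M) where
  carrier := {c | ∃ δ : G → M, ∀ x y, c x y = δ y * (δ (x * y))⁻¹ * δ x}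
  one_mem' := ⟨1, fun x y => by simp⟩
  mul_mem' := by
    rintro a b ⟨d, hd⟩ ⟨e, he⟩
    refine ⟨d * e, fun x y => ?_⟩
    simp only [Pi.mul_apply, hd, he, mul_inv]
    ac_rfl
  inv_mem' := by
    rintro a ⟨d, hd⟩
    refine ⟨d⁻¹, fun x y => ?_⟩
    simp only [Pi.inv_apply, hd, mul_inv]

/-- `H²(G, M) = Z²(G, M) / B²(G, M)`, where `G` acts trivially on `M`
(written multiplicatively). -/
abbrev H2 := Z2 G M ⧸ (B2 G M).subgroupOf (Z2 G M)

end Cohomology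

/-! ### Regular matrices and the Jordan canonical form -/

section Matrices

variable {k : Type*} [Field k]

/-- A square matrix over a field is regular if its characteristic polynomial is equal to its
minimal polynomial. -/
def IsRegular {n : ℕ} (A : Matrix (Fin n) (Fin n) k) : Prop :=
  A.charpoly = minpoly k A

/-- The `m × m` Jordan block with diagonal entries `a` and entries `1` above the diagonal. -/
def jordanBlock (m : ℕ) (a : k) : Matrix (Fin m) (Fin m) k :=
  Matrix.of fun i j => if i = j then a else if (i : ℕ) + 1 = j then 1 else 0

/-- `A` has the Jordan canonical form `diag(J_{m_1}(a_1), …, J_{m_f}(a_f))` with non-empty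
blocks and with distinct eigenvalues `a_1, …, a_f`. -/
def HasJordanForm {n f : ℕ} (A : Matrix (Fin n) (Fin n) k) (m : Fin f → ℕ) (a : Fin f → k) :
    Prop :=
  (∀ i, 0 < m i) ∧ Function.Injective a ∧
    ∃ (e : Fin n ≃ (i : Fin f) × Fin (m i)) (P : GL (Fin n) k),
      (P : Matrix (Fin n) (Fin n) k) * A * ((P⁻¹ : GL (Fin n) k) : Matrix (Fin n) (Fin n) k) =
        Matrix.reindex e.symm e.symm (Matrix.blockDiagonal' fun i => jordanBlock (m i) (a i))

end Matrices

/-! ### Congruence subgroups of `GL_n(O / 𝔭^r)` -/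

section LocalField

variable {F : Type*} [Field F] [ValuativeRel F]

variable (F) in
/-- The residue class ring `O_r = O / 𝔭^r`. -/
abbrev ResRing (r : ℕ) : Type _ := 𝒪[F] ⧸ (𝓂[F] ^ r)

variable (F) in
/-- The group `G_r = GL_n(O_r)`. -/
abbrev G (n r : ℕ) : Type _ := GL (Fin n) (ResRing F r)

/-- Reduction modulo `𝔭^r` of a matrix over `O`. -/
abbrev redMod {n : ℕ} (r : ℕ) (X : Matrix (Fin n) (Fin n) 𝒪[F]) :
    Matrix (Fin n) (Fin n) (ResRing F r) :=
  X.map (Ideal.Quotient.mk (𝓂[F] ^ r))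

/-- Reduction modulo `𝔭` of a matrix over `O`, as a matrix over the residue field. -/
abbrev residueMat {n : ℕ} (X : Matrix (Fin n) (Fin n) 𝒪[F]) : Matrix (Fin n) (Fin n) 𝓀[F] :=
  X.map (IsLocalRing.residue 𝒪[F])

variable (F) in
/-- The group `K_i`, the kernel of the reduction map `G_r → G_i`. -/
def K (n : ℕ) {i r : ℕ} (hir : i ≤ r) : Subgroup (G F n r) :=
  (Matrix.GeneralLinearGroup.map (n := Fin n)
    (Ideal.Quotient.factor (Ideal.pow_le_pow_right (I := 𝓂[F]) hir))).ker

instance (n : ℕ) {i r : ℕ} (hir : i ≤ r) : (K F n hir).Normal :=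
  inferInstanceAs (MonoidHom.ker _).Normal

lemma map_redMod_mul {n : ℕ} (r : ℕ) (X Y : Matrix (Fin n) (Fin n) 𝒪[F]) :
    redMod r (X * Y) = redMod r X * redMod r Y := Matrix.map_mul

lemma exists_redMod {n r : ℕ} (Z : Matrix (Fin n) (Fin n) (ResRing F r)) :
    ∃ X : Matrix (Fin n) (Fin n) 𝒪[F], redMod r X = Z := by
  choose g hg using Ideal.Quotient.mk_surjective (I := 𝓂[F] ^ r)
  exact ⟨Z.map g, by ext i j; simp [hg]⟩

lemma residueMat_eq_of_redMod_eq {n r : ℕ} (hr : 0 < r) {X Y : Matrix (Fin n) (Fin n) 𝒪[F]}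
    (h : redMod r X = redMod r Y) : residueMat X = residueMat Y := by
  ext a b
  have h1 := congrFun (congrFun h a) b
  simp only [Matrix.map_apply] at h1 ⊢
  rw [Ideal.Quotient.eq] at h1
  exact Ideal.Quotient.eq.2 (Ideal.pow_le_self hr.ne' h1)

/-- For an additive subgroup `U` of `M_n(𝔽)`, the inverse image `K_i(U)` of `U` under the
homomorphism `1 + ϖ^i X mod 𝔭^r ↦ X mod 𝔭` of `K_i` onto `M_n(𝔽)`. -/
def KSub {n i r : ℕ} (ϖ : 𝒪[F]) (hϖ : Irreducible ϖ) (hi : 0 < i) (hir : i ≤ r)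
    (U : AddSubgroup (Matrix (Fin n) (Fin n) 𝓀[F])) : Subgroup (K F n hir) where
  carrier := {k | ∃ X : Matrix (Fin n) (Fin n) 𝒪[F],
    ((k : G F n r) : Matrix (Fin n) (Fin n) (ResRing F r)) = redMod r (1 + ϖ ^ i • X) ∧
      residueMat X ∈ U}
  one_mem' := ⟨0, by ext a b; by_cases h : a = b <;> simp [h], by
    have : residueMat (0 : Matrix (Fin n) (Fin n) 𝒪[F]) = 0 := by ext a b; simp
    rw [this]; exact U.zero_mem⟩
  mul_mem' := by
    have hϖ0 : IsLocalRing.residue 𝒪[F] ϖ = 0 := by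
      rw [IsLocalRing.residue_eq_zero_iff]; exact hϖ.not_isUnit
    rintro x y ⟨X, hX, hXU⟩ ⟨Y, hY, hYU⟩
    refine ⟨X + Y + ϖ ^ i • (X * Y), ?_, ?_⟩
    · rw [Subgroup.coe_mul, Units.val_mul, hX, hY, ← map_redMod_mul]
      congr 1
      simp only [mul_add, add_mul, one_mul, mul_one, Matrix.smul_mul, Matrix.mul_smul, smul_add]
      abel
    · have : residueMat (X + Y + ϖ ^ i • (X * Y)) = residueMat X + residueMat Y := by
        ext a b; simp [hϖ0, hi.ne']
      rw [this]; exact U.add_mem hXU hYU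
  inv_mem' := by
    have hϖ0 : IsLocalRing.residue 𝒪[F] ϖ = 0 := by
      rw [IsLocalRing.residue_eq_zero_iff]; exact hϖ.not_isUnit
    rintro x ⟨X, hX, hXU⟩
    obtain ⟨Z, hZ⟩ := exists_redMod (((x⁻¹ : K F n hir) : G F n r) :
      Matrix (Fin n) (Fin n) (ResRing F r))
    have h1 : redMod r ((1 + ϖ ^ i • X) * Z) = redMod r 1 := by
      rw [map_redMod_mul, ← hX, hZ, ← Units.val_mul, ← Subgroup.coe_mul, mul_inv_cancel]
      ext a b; by_cases h : a = b <;> simp [h]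
    have hZ1 : residueMat Z = 1 := by
      have h2 := residueMat_eq_of_redMod_eq (hi.trans_le hir) h1
      have h3 : residueMat (1 + ϖ ^ i • X) = 1 := by
        ext a b; by_cases h : a = b <;> simp [hϖ0, hi.ne', h, Matrix.one_apply]
      have h4 : residueMat (1 : Matrix (Fin n) (Fin n) 𝒪[F]) = 1 := by
        ext a b; by_cases h : a = b <;> simp [h, Matrix.one_apply]
      have h5 : residueMat ((1 + ϖ ^ i • X) * Z) = residueMat (1 + ϖ ^ i • X) * residueMat Z :=
        Matrix.map_mul
      rwa [h5, h3, h4, one_mul] at h2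
    refine ⟨-(X * Z), ?_, ?_⟩
    · rw [← hZ]
      have h6 : (1 + ϖ ^ i • X) * Z = Z + ϖ ^ i • (X * Z) := by
        simp [add_mul]
      rw [h6] at h1
      ext a b
      have h7 := congrFun (congrFun h1 a) b
      simp only [Matrix.map_apply, Matrix.add_apply, Matrix.smul_apply, Matrix.neg_apply,
        map_add, smul_eq_mul, map_mul, map_neg] at h7 ⊢
      rw [← h7]; ring
    · have h8 : residueMat (-(X * Z)) = -(residueMat X * residueMat Z) := by
        have : residueMat (X * Z) = residueMat X * residueMat Z := Matrix.map_mul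
        rw [← this]; ext a b; simp only [Matrix.map_apply, Matrix.neg_apply, map_neg]
      rw [h8, hZ1, mul_one]; exact U.neg_mem hXU

/-- The subalgebra `𝔽[β̄]` of `M_n(𝔽)`, as an additive group. -/
def resAlg {n : ℕ} (β : Matrix (Fin n) (Fin n) 𝒪[F]) :
    AddSubgroup (Matrix (Fin n) (Fin n) 𝓀[F]) :=
  (Subalgebra.toSubmodule (Algebra.adjoin 𝓀[F] {residueMat β})).toAddSubgroup

/-- The group `𝒞 = (O_r[β_r])ˣ`, where `β_r = β mod 𝔭^r`, as a subgroup of `G_r`. -/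
def C {n : ℕ} (r : ℕ) (β : Matrix (Fin n) (Fin n) 𝒪[F]) : Subgroup (G F n r) :=
  (Units.map ((Algebra.adjoin (ResRing F r) {redMod r β}).val :
    Algebra.adjoin (ResRing F r) {redMod r β} →*
      Matrix (Fin n) (Fin n) (ResRing F r))).range

/-! ### The characters `ψ` and the Schur multiplier `c(ψ)`, for `r = 2l - 1` -/

variable (F) in
/-- The group `K_{l-1}` inside `G_r`, where `r = 2l - 1`. -/
abbrev Kpred (n l : ℕ) : Subgroup (G F n (2 * l - 1)) :=
  K F n (i := l - 1) (r := 2 * l - 1)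
    (Nat.sub_le_sub_right (Nat.le_mul_of_pos_left l Nat.two_pos) 1)

/-- The subgroup `K_{l-1}(𝔽[β̄])` of `K_{l-1}`, where `r = 2l - 1`. -/
abbrev KpredBeta {n : ℕ} (ϖ : 𝒪[F]) (hϖ : Irreducible ϖ) (l : ℕ) (hl : 2 ≤ l)
    (β : Matrix (Fin n) (Fin n) 𝒪[F]) : Subgroup (Kpred F n l) :=
  KSub ϖ hϖ (i := l - 1) (r := 2 * l - 1) (Nat.sub_pos_of_lt hl)
    (Nat.sub_le_sub_right (Nat.le_mul_of_pos_left l Nat.two_pos) 1) (resAlg β)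

/-- The set `Y(ψ_β)` of the homomorphisms `ψ : K_{l-1}(𝔽[β̄]) → ℂˣ` whose restriction to `K_l`
is the character `ψ_β (1 + ϖ^l X mod 𝔭^r) = τ(ϖ^{-l'} tr(X β))`, where `l' = r - l = l - 1`. -/
def Y {n : ℕ} (ϖ : 𝒪[F]) (hϖ : Irreducible ϖ) (τ : AddChar F Circle) (l : ℕ) (hl : 2 ≤ l)
    (β : Matrix (Fin n) (Fin n) 𝒪[F]) : Set (KpredBeta ϖ hϖ l hl β →* ℂˣ) :=
  {ψ | ∀ (k : KpredBeta ϖ hϖ l hl β) (X : Matrix (Fin n) (Fin n) 𝒪[F]),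
    (((k : Kpred F n l) : G F n (2 * l - 1)) :
        Matrix (Fin n) (Fin n) (ResRing F (2 * l - 1))) = redMod (2 * l - 1) (1 + ϖ ^ l • X) →
      ((ψ k : ℂˣ) : ℂ) = (τ (((ϖ : F) ^ (l - 1))⁻¹ * ((X * β).trace : 𝒪[F])) : ℂ)}

/-- The one-dimensional representation of a group given by a homomorphism to `ℂˣ`. -/
def charRep {Γ : Type*} [Group Γ] (ψ : Γ →* ℂˣ) : Representation ℂ Γ ℂ :=
  (Algebra.lmul ℂ ℂ : ℂ →* Module.End ℂ ℂ).comp ((Units.coeHom ℂ).comp ψ)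

/-- `(π, H)` is an irreducible complex representation `π_ψ` of `K_{l-1}` such that
`⟨ψ, π⟩ = dim Hom(ψ, π) > 0` over `K_{l-1}(𝔽[β̄])`. -/
def IsPiPsi {n : ℕ} {ϖ : 𝒪[F]} {hϖ : Irreducible ϖ} {l : ℕ} {hl : 2 ≤ l}
    {β : Matrix (Fin n) (Fin n) 𝒪[F]} (ψ : KpredBeta ϖ hϖ l hl β →* ℂˣ)
    {H : Type} [AddCommGroup H] [Module ℂ H] (π : Representation ℂ (Kpred F n l) H) : Prop :=
  π.IsIrreducible ∧
    0 < Module.finrank ℂ ((charRep ψ).IntertwiningMap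
      (π.comp (KpredBeta ϖ hϖ l hl β).subtype))

/-- `c ∈ H²(𝒞, ℂˣ)` is a Schur multiplier `c(ψ)` of `ψ`: there are a representation `π_ψ` and
operators `U(ε) ∈ GL(H_ψ)`, `ε ∈ 𝒞`, with `π_ψ(ε k ε⁻¹) = U(ε) π_ψ(k) U(ε)⁻¹` for all
`k ∈ K_{l-1}`, and `c` is the class of the 2-cocycle `c_U` determined by
`U(ε) U(η) = c_U(ε, η) U(ε η)`. -/
def IsSchurMultiplier {n : ℕ} {ϖ : 𝒪[F]} {hϖ : Irreducible ϖ} {l : ℕ} {hl : 2 ≤ l}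
    {β : Matrix (Fin n) (Fin n) 𝒪[F]} (ψ : KpredBeta ϖ hϖ l hl β →* ℂˣ)
    (c : H2 (C (2 * l - 1) β) ℂˣ) : Prop :=
  ∃ (H : Type) (_ : AddCommGroup H) (_ : Module ℂ H)
    (π : Representation ℂ (Kpred F n l) H)
    (U : C (2 * l - 1) β → LinearMap.GeneralLinearGroup ℂ H) (cU : Z2 (C (2 * l - 1) β) ℂˣ),
    IsPiPsi ψ π ∧
    (∀ (ε : C (2 * l - 1) β) (k : Kpred F n l),
      π (MulAut.conjNormal (ε : G F n (2 * l - 1)) k) =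
        (U ε : Module.End ℂ H) * π k * ((U ε)⁻¹ : LinearMap.GeneralLinearGroup ℂ H)) ∧
    (∀ ε η : C (2 * l - 1) β,
      (U ε : Module.End ℂ H) * U η =
        (((cU : C (2 * l - 1) β → C (2 * l - 1) β → ℂˣ) ε η : ℂˣ) : ℂ) •
          (U (ε * η) : Module.End ℂ H)) ∧
    c = QuotientGroup.mk cU

/-- The Schur multiplier `c(ψ) ∈ H²(𝒞, ℂˣ)` is well defined (it exists and does not depend on
the choice of `π_ψ` and `U`) and trivial for all `ψ ∈ Y(ψ_β)`. -/
def SchurMultipliersTrivial {n : ℕ} (ϖ : 𝒪[F]) (hϖ : Irreducible ϖ) (τ : AddChar F Circle)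
    (l : ℕ) (hl : 2 ≤ l) (β : Matrix (Fin n) (Fin n) 𝒪[F]) : Prop :=
  ∀ ψ ∈ Y ϖ hϖ τ l hl β, ∀ c : H2 (C (2 * l - 1) β) ℂˣ, IsSchurMultiplier ψ c ↔ c = 1

end LocalField

end RegularChar

end

/-! Everything takes place on M_n(𝔽) with the alternating form ω(X, Y) = tr([X, Y] β̄) (`comForm`).
Its radical is the centralizer of β̄, which is 𝔽[β̄] by regularity. Since 2 is invertible, a
truncated exponential turns multiplication in K_{l-1} into the second-order Baker–Campbell–Hausdorff
formula, and π_ψ(exp X) = Ψ(X) W(X̄) with Ψ an additive character (`exists_isExtChar`) and W an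
irreducible system of Weyl operators for ω (`exists_isWeylSystem`).

Let ε ∈ 𝒞 reduce to e = p(β̄). Conjugation by ε multiplies Ψ by X ↦ χ(tr(e X e⁻¹ M) - tr(X M)),
where M records how ψ differs from the invariant trace character. With δ_p = (p(L) - p(R)) / (L -
R), the vector g_e = -δ_p(M) e⁻¹ represents this defect through ω. Hence U(ε) = W(g_e) T_e, where
T_e implements plain conjugation by e on the Weyl operators.

As 𝒞 is abelian, U(ε) and U(η) commute up to a scalar. If all these scalars are 1, the operators
have a common eigenvector, and its eigenvalues exhibit c_U as a coboundary (`mk_eq_one_of_commute`).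
The scalars are 1 for two reasons (`commutator_eq_one`). The translations contribute nothing,
because g_e + e g_f e⁻¹ and ω(g_e, e g_f e⁻¹) are symmetric in e and f. What is left is T_e T_f = c
T_f T_e, which makes T_e conjugate to c T_e; since tr T_e ≠ 0 (`trace_ne_zero`), c = 1.

That a multiplier exists at all comes from the regular representation (`exists_representation`) and
from the averaging argument of Stone–von Neumann type in `exists_intertwiner`. -/

noncomputable section

namespace RegularChar

/-! ### The form tr([X, Y] β) and divided differences of left and right multiplication -/

section DividedDifference

open Polynomial Matrix

variable {k ι : Type*} [Field k] [Fintype ι]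

/-- The form `tr([X, Y] β)`. -/
def comForm (β X Y : Matrix ι ι k) : k := ((X * Y - Y * X) * β).trace

lemma comForm_eq (β X Y : Matrix ι ι k) : comForm β X Y = (X * (Y * β - β * Y)).trace := by
  rw [comForm, sub_mul, mul_sub, trace_sub, trace_sub, mul_assoc, mul_assoc,
    Matrix.trace_mul_comm Y, mul_assoc]

lemma comForm_swap (β X Y : Matrix ι ι k) : comForm β Y X = -comForm β X Y := by
  rw [comForm, comForm, ← trace_neg, ← neg_mul, neg_sub]

lemma comForm_add_left (β X X' Y : Matrix ι ι k) :
    comForm β (X + X') Y = comForm β X Y + comForm β X' Y := by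
  rw [comForm_eq, comForm_eq, comForm_eq, add_mul, trace_add]

lemma comForm_neg_left (β X Y : Matrix ι ι k) : comForm β (-X) Y = -comForm β X Y := by
  rw [comForm_eq, comForm_eq, neg_mul, trace_neg]

lemma comForm_add_right (β X Y Y' : Matrix ι ι k) :
    comForm β X (Y + Y') = comForm β X Y + comForm β X Y' := by
  rw [comForm_swap, comForm_add_left, comForm_swap β X Y, comForm_swap β X Y']; ring

lemma comForm_neg_right (β X Y : Matrix ι ι k) : comForm β X (-Y) = -comForm β X Y := by
  rw [comForm_swap, comForm_neg_left, comForm_swap β X, neg_neg]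

lemma comForm_self (β X : Matrix ι ι k) : comForm β X X = 0 := by simp [comForm]

variable [DecidableEq ι]

/-- The divided difference `(p(L) - p(R)) / (L - R)`, where `L` and `R` are the left and the right
multiplication by `β` on square matrices. -/
def divDiff (β : Matrix ι ι k) (p : k[X]) : Module.End k (Matrix ι ι k) :=
  p.sum fun i c => c • ∑ a ∈ Finset.range i,
    LinearMap.mulLeft k β ^ a * LinearMap.mulRight k β ^ (i - 1 - a)

lemma divDiff_apply (β : Matrix ι ι k) (p : k[X]) (Z : Matrix ι ι k) :
    divDiff β p Z = p.sum fun i c => c • ∑ a ∈ Finset.range i, β ^ a * Z * β ^ (i - 1 - a) := by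
  simp [divDiff, Polynomial.sum, LinearMap.sum_apply, LinearMap.pow_mulLeft,
    LinearMap.pow_mulRight, mul_assoc]

lemma divDiff_mul_right (β : Matrix ι ι k) (p : k[X]) (Z c : Matrix ι ι k) (hc : Commute c β) :
    divDiff β p (Z * c) = divDiff β p Z * c := by
  simp only [divDiff_apply, Polynomial.sum, Finset.sum_mul, smul_mul_assoc]
  refine Finset.sum_congr rfl fun i _ => congrArg _ (Finset.sum_congr rfl fun a _ => ?_)
  rw [mul_assoc _ _ c, ← (hc.pow_right _).eq]
  simp only [mul_assoc]

lemma divDiff_mul_left (β : Matrix ι ι k) (p : k[X]) (Z c : Matrix ι ι k) (hc : Commute c β) :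
    divDiff β p (c * Z) = c * divDiff β p Z := by
  simp only [divDiff_apply, Polynomial.sum, Finset.mul_sum, mul_smul_comm]
  refine Finset.sum_congr rfl fun i _ => congrArg _ (Finset.sum_congr rfl fun a _ => ?_)
  simp only [← mul_assoc]
  rw [(hc.pow_right _).eq]

/-- This is (L - R) δ_p = p(L) - p(R), a geometric sum in each degree. -/
lemma commutator_divDiff (β : Matrix ι ι k) (p : k[X]) (Z : Matrix ι ι k) :
    β * divDiff β p Z - divDiff β p Z * β = aeval β p * Z - Z * aeval β p := by
  have key (i : ℕ) : β * (∑ a ∈ Finset.range i, β ^ a * Z * β ^ (i - 1 - a)) -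
      (∑ a ∈ Finset.range i, β ^ a * Z * β ^ (i - 1 - a)) * β = β ^ i * Z - Z * β ^ i := by
    have h := (LinearMap.commute_mulLeft_right (R := k) β β).mul_geom_sum₂ i
    have h := LinearMap.congr_fun h Z
    simpa [LinearMap.sum_apply, LinearMap.pow_mulLeft, LinearMap.pow_mulRight, sub_mul,
      Finset.mul_sum, Finset.sum_mul, mul_assoc] using h
  rw [divDiff_apply, aeval_eq_sum_range, Polynomial.sum_over_range _ (by simp), Finset.mul_sum,
    Finset.sum_mul, Finset.sum_mul, Finset.mul_sum, ← Finset.sum_sub_distrib,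
    ← Finset.sum_sub_distrib]
  refine Finset.sum_congr rfl fun i _ => ?_
  rw [mul_smul_comm, smul_mul_assoc, smul_mul_assoc, mul_smul_comm, ← smul_sub, ← smul_sub, key]

/-- Both operators are polynomials in the commuting operators L and R. -/
lemma divDiff_comm (β : Matrix ι ι k) (p q : k[X]) (Z : Matrix ι ι k) :
    divDiff β p (divDiff β q Z) = divDiff β q (divDiff β p Z) := by
  simp only [divDiff_apply β p, Polynomial.sum, map_sum, map_smul]
  refine Finset.sum_congr rfl fun i _ => congrArg _ (Finset.sum_congr rfl fun a _ => ?_)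
  rw [divDiff_mul_right _ _ _ _ ((Commute.refl β).pow_left _),
    divDiff_mul_left _ _ _ _ ((Commute.refl β).pow_left _)]

/-- L and R are adjoint to each other for the trace form, and a divided difference is symmetric in
its two variables, so δ_p is self-adjoint. -/
lemma trace_divDiff_mul (β : Matrix ι ι k) (p : k[X]) (Z T : Matrix ι ι k) :
    (divDiff β p Z * T).trace = (Z * divDiff β p T).trace := by
  simp only [divDiff_apply, Polynomial.sum, Finset.mul_sum, Finset.sum_mul, trace_sum,
    smul_mul_assoc, mul_smul_comm, trace_smul]
  refine Finset.sum_congr rfl fun i _ => congrArg _ ?_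
  rw [← Finset.sum_range_reflect]
  refine Finset.sum_congr rfl fun a ha => ?_
  have : i - 1 - (i - 1 - a) = a := by have := Finset.mem_range.1 ha; omega
  rw [this, mul_assoc, mul_assoc, Matrix.trace_mul_comm, mul_assoc, mul_assoc]

lemma comForm_conj (β X Y e e' : Matrix ι ι k) (he : e' * e = 1) (hc : Commute e β) :
    comForm β (e * X * e') (e * Y * e') = comForm β X Y := by
  have h1 : e * X * e' * (e * Y * e') = e * (X * Y) * e' := by
    calc _ = e * X * (e' * e) * Y * e' := by simp only [mul_assoc]
      _ = _ := by rw [he, mul_one]; simp only [mul_assoc]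
  have h2 : e * Y * e' * (e * X * e') = e * (Y * X) * e' := by
    calc _ = e * Y * (e' * e) * X * e' := by simp only [mul_assoc]
      _ = _ := by rw [he, mul_one]; simp only [mul_assoc]
  rw [comForm, comForm, h1, h2, ← sub_mul, ← mul_sub, mul_assoc, mul_assoc, Matrix.trace_mul_comm,
    mul_assoc, mul_assoc, ← hc.eq, ← mul_assoc e', he, one_mul]

/-- An explicit solution g_e of [β, g] = M - e M e⁻¹. By `comForm_eq` it represents through ω the
defect character that U(ε) must absorb. -/
lemma commutator_neg_divDiff_mul (β M e e' : Matrix ι ι k) (p : k[X]) (hp : aeval β p = e)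
    (he : e * e' = 1) (he' : Commute e' β) :
    β * (-divDiff β p M * e') - (-divDiff β p M * e') * β = M - e * M * e' := by
  have h := commutator_divDiff β p M
  calc _ = -(β * divDiff β p M - divDiff β p M * β) * e' := by
        rw [mul_assoc _ e', he'.eq]; noncomm_ring
    _ = _ := by rw [h, hp]; simp [sub_mul, mul_assoc, he]

/-- Both sides are (L - R) δ_p δ_q M. -/
lemma commutator_divDiff_symm (β M e f : Matrix ι ι k) (p q : k[X]) (hp : aeval β p = e)
    (hq : aeval β q = f) :
    e * divDiff β q M - divDiff β q M * e = f * divDiff β p M - divDiff β p M * f := by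
  rw [← hp, ← hq, ← commutator_divDiff, ← commutator_divDiff, divDiff_comm]

/-- The map e ↦ g_e is a cocycle, because δ_{pq} = p(L) δ_q + q(R) δ_p; both sides are the value at
ef = fe. -/
lemma neg_divDiff_cocycle_symm (β M e e' f f' : Matrix ι ι k) (p q : k[X]) (hp : aeval β p = e)
    (hq : aeval β q = f) (he : e * e' = 1) (hf : f * f' = 1) (hef : Commute e' f') :
    -divDiff β p M * e' + e * (-divDiff β q M * f') * e' =
      -divDiff β q M * f' + f * (-divDiff β p M * e') * f' := by
  have h := commutator_divDiff_symm β M e f p q hp hq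
  have h' : divDiff β p M * f + e * divDiff β q M = divDiff β q M * e + f * divDiff β p M := by
    rw [sub_eq_sub_iff_add_eq_add] at h
    rw [add_comm, h, add_comm]
  calc _ = -((divDiff β p M * f + e * divDiff β q M) * (f' * e')) := by
        have : divDiff β p M * e' = divDiff β p M * f * (f' * e') := by
          rw [mul_assoc, ← mul_assoc f, hf, one_mul]
        simp only [neg_mul, mul_neg, add_mul, neg_add]
        rw [this]; simp only [mul_assoc]
    _ = _ := by
        have : divDiff β q M * f' = divDiff β q M * e * (e' * f') := by
          rw [mul_assoc, ← mul_assoc e, he, one_mul]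
        rw [h', ← hef.eq]
        simp only [neg_mul, mul_neg, add_mul, neg_add]
        rw [this]; simp only [mul_assoc]

/-- Self-adjointness moves δ_p to the other factor and gives tr(M [δ_p δ_q M, β] f⁻¹ e⁻¹), which is
symmetric since everything that is exchanged commutes. -/
lemma comForm_neg_divDiff_symm (β M e e' f f' : Matrix ι ι k) (p q : k[X]) (hp : aeval β p = e)
    (hq : aeval β q = f) (he : e' * e = 1) (hf : f' * f = 1) (hef : Commute e' f')
    (he' : Commute e' β) (hf' : Commute f' β) :
    comForm β (-divDiff β p M * e') (e * (-divDiff β q M * f') * e') =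
      comForm β (-divDiff β q M * f') (f * (-divDiff β p M * e') * f') := by
  have key (e e' f f' : Matrix ι ι k) (p q : k[X]) (hp : aeval β p = e) (he : e' * e = 1)
      (he' : Commute e' β) (hf' : Commute f' β) :
      comForm β (-divDiff β p M * e') (e * (-divDiff β q M * f') * e') =
        (M * (divDiff β p (divDiff β q M) * β - β * divDiff β p (divDiff β q M)) *
          (f' * e')).trace := by
    have heβ : Commute β e := hp ▸ by simpa using (Commute.all X p).map (aeval β)
    have h1 : e * (-divDiff β q M * f') * e' * β - β * (e * (-divDiff β q M * f') * e') =
        -(e * ((divDiff β q M * β - β * divDiff β q M) * (f' * e'))) := by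
      have h2 : e * (-divDiff β q M * f') * e' * β = -(e * (divDiff β q M * β * (f' * e'))) := by
        rw [mul_assoc _ e', he'.eq, ← mul_assoc, mul_assoc e, mul_assoc _ f', hf'.eq]
        simp [mul_assoc]
      have h3 : β * (e * (-divDiff β q M * f') * e') = -(e * (β * divDiff β q M * (f' * e'))) := by
        rw [← mul_assoc, ← mul_assoc, heβ.eq]
        simp [mul_assoc]
      rw [h2, h3]; noncomm_ring
    rw [comForm_eq, h1, mul_neg, neg_mul, neg_mul, neg_neg, mul_assoc, ← mul_assoc e', he, one_mul,
      trace_divDiff_mul, divDiff_mul_right _ _ _ _ (hf'.mul_left he'), map_sub,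
      divDiff_mul_right _ _ _ _ (Commute.refl β), divDiff_mul_left _ _ _ _ (Commute.refl β),
      mul_assoc]
  rw [key e e' f f' p q hp he he' hf', key f f' e e' q p hq hf hf' he', hef.eq, divDiff_comm]

end DividedDifference

/-! ### Weyl operators, their intertwiners and the commutator of two intertwiners -/

section Weyl

open Polynomial Matrix

variable {k ι H : Type*} [Field k] [Fintype k] [Fintype ι] [DecidableEq ι]
  [AddCommGroup H] [Module ℂ H]

/-- An irreducible system of Weyl operators for the alternating form `tr([X, Y] β)`. -/
structure IsWeylSystem (χ : AddChar k ℂ) (β : Matrix ι ι k) (W : Matrix ι ι k → Module.End ℂ H) :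
    Prop where
  mul (X Y) : W X * W Y = χ (2⁻¹ * comForm β X Y) • W (X + Y)
  central (X) : Commute X β → W X = 1
  irred (p : Submodule ℂ H) : (∀ X, ∀ v ∈ p, W X v ∈ p) → p = ⊥ ∨ p = ⊤

namespace IsWeylSystem

variable {χ : AddChar k ℂ} {β : Matrix ι ι k} {W : Matrix ι ι k → Module.End ℂ H}

omit [Fintype k] [DecidableEq ι] in
lemma mul_neg_self (hW : IsWeylSystem χ β W) (X : Matrix ι ι k) : W X * W (-X) = 1 := by
  rw [hW.mul, comForm_neg_right, comForm_self, neg_zero, mul_zero, AddChar.map_zero_eq_one,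
    one_smul, add_neg_cancel, hW.central 0 (Commute.zero_left β)]

omit [Fintype k] [DecidableEq ι] in
lemma neg_mul_self (hW : IsWeylSystem χ β W) (X : Matrix ι ι k) : W (-X) * W X = 1 := by
  simpa using hW.mul_neg_self (-X)

omit [Fintype k] [DecidableEq ι] in
lemma conj (hW : IsWeylSystem χ β W) (h2 : (2 : k) ≠ 0) (Y X : Matrix ι ι k) :
    W Y * W X = χ (comForm β Y X) • (W X * W Y) := by
  rw [hW.mul, hW.mul, smul_smul, ← AddChar.map_add_eq_mul, add_comm X Y, comForm_swap β Y X]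
  congr 2
  field_simp
  ring

omit [Fintype k] in
-- For X outside the radical some W Y conjugates W X to a multiple of itself by χ(ω(Y, X)) ≠ 1. A
-- scaled matrix unit, placed opposite a nonzero entry of [X, β], serves as Y.
lemma trace_eq_zero (hW : IsWeylSystem χ β W) (h2 : (2 : k) ≠ 0) (hχ : χ ≠ 1)
    {X : Matrix ι ι k} (hX : ¬ Commute X β) : LinearMap.trace ℂ H (W X) = 0 := by
  obtain ⟨c, hc⟩ := AddChar.ne_one_iff.1 hχ
  obtain ⟨i, j, hij⟩ : ∃ i j, (X * β - β * X) i j ≠ 0 := by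
    by_contra! h
    exact hX (sub_eq_zero.1 (Matrix.ext h))
  set D := X * β - β * X
  have hY : comForm β (Matrix.single j i (c / D i j)) X = c := by
    rw [comForm_eq, Matrix.trace_single_mul]
    exact div_mul_cancel₀ c hij
  have h := hW.conj h2 (Matrix.single j i (c / D i j)) X
  rw [hY] at h
  set Y := Matrix.single j i (c / D i j)
  have h1 : LinearMap.trace ℂ H (W X) = χ c * LinearMap.trace ℂ H (W X) := by
    calc _ = LinearMap.trace ℂ H (W (-Y) * (W Y * W X)) := by
          rw [← mul_assoc, hW.neg_mul_self, one_mul]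
      _ = χ c * LinearMap.trace ℂ H (W (-Y) * (W X * W Y)) := by
          rw [h, mul_smul_comm, map_smul, smul_eq_mul]
      _ = _ := by
          rw [LinearMap.trace_mul_comm, mul_assoc, hW.mul_neg_self, mul_one]
  have h3 : (1 - χ c) * LinearMap.trace ℂ H (W X) = 0 := by linear_combination h1
  exact (mul_eq_zero.1 h3).resolve_left (sub_ne_zero.2 hc.symm)

omit [Fintype k] [DecidableEq ι] in
-- Schur's lemma for the Weyl system.
lemma exists_eq_smul_one [FiniteDimensional ℂ H] (hW : IsWeylSystem χ β W) {T : Module.End ℂ H}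
    (hT : ∀ X, W X * T = T * W X) : ∃ c : ℂ, T = c • 1 := by
  cases subsingleton_or_nontrivial H
  · exact ⟨0, LinearMap.ext fun v => Subsingleton.elim _ _⟩
  obtain ⟨c, hc⟩ := Module.End.exists_eigenvalue T
  refine ⟨c, ?_⟩
  have h := (hW.irred (Module.End.eigenspace T c) fun X v hv => by
    rw [Module.End.mem_eigenspace_iff] at hv ⊢
    rw [← Module.End.mul_apply, ← hT, Module.End.mul_apply, hv, map_smul]).resolve_left hc
  ext v
  have : v ∈ Module.End.eigenspace T c := h ▸ Submodule.mem_top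
  simpa using Module.End.mem_eigenspace_iff.1 this

/-- Averaging any T produces an intertwiner: after the substitution X ↦ Y + X the two phases agree,
because conjugation by e preserves ω. -/
lemma sum_mul_comm (hW : IsWeylSystem χ β W) {e e' : Matrix ι ι k} (he : e' * e = 1)
    (heβ : Commute e β) (T : Module.End ℂ H) (Y : Matrix ι ι k) :
    (∑ X, W (e * X * e') * T * W (-X)) * W Y =
      W (e * Y * e') * ∑ X, W (e * X * e') * T * W (-X) := by
  rw [Finset.mul_sum, Finset.sum_mul, ← Equiv.sum_comp (Equiv.addLeft Y)]
  refine Finset.sum_congr rfl fun X _ => ?_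
  simp only [Equiv.coe_addLeft]
  have e1 : W (e * Y * e') * W (e * X * e') =
      χ (2⁻¹ * comForm β Y X) • W (e * (Y + X) * e') := by
    rw [hW.mul, comForm_conj β _ _ _ _ he heβ, mul_add, add_mul]
  have e2 : W (-(Y + X)) * W Y = χ (2⁻¹ * comForm β Y X) • W (-X) := by
    rw [hW.mul, comForm_neg_left, comForm_add_left, comForm_self, zero_add, ← comForm_swap]
    congr 2; abel
  rw [mul_assoc, e2, ← mul_assoc, ← mul_assoc, e1, smul_mul_assoc, smul_mul_assoc, mul_smul_comm]

/-- The average is a scalar by Schur's lemma, and its trace is a multiple of tr T. -/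
lemma sum_conj_eq_zero [FiniteDimensional ℂ H] [Nontrivial H] (hW : IsWeylSystem χ β W)
    {T : Module.End ℂ H} (hT : LinearMap.trace ℂ H T = 0) :
    ∑ X, W X * T * W (-X) = 0 := by
  have hc (Y) : W Y * (∑ X, W X * T * W (-X)) = (∑ X, W X * T * W (-X)) * W Y := by
    simpa using (hW.sum_mul_comm (mul_one 1) (Commute.one_left β) T Y).symm
  obtain ⟨c, hc⟩ := hW.exists_eq_smul_one hc
  have h := congrArg (LinearMap.trace ℂ H) hc
  have h1 (X) : LinearMap.trace ℂ H (W X * T * W (-X)) = 0 := by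
    rw [LinearMap.trace_mul_comm, ← mul_assoc, hW.neg_mul_self, one_mul, hT]
  rw [map_sum, Finset.sum_eq_zero fun X _ => h1 X, map_smul, LinearMap.trace_one, smul_eq_mul,
    eq_comm, mul_eq_zero] at h
  rw [hc, h.resolve_right (by exact_mod_cast Module.finrank_pos.ne'), zero_smul]

/-- If tr T = 0, the conjugates of T by the W X sum to zero. Multiplied by T⁻¹, each conjugate
becomes a phase times W(X - e X e⁻¹), of trace zero unless X - e X e⁻¹ is in the radical, where the
trace is dim H. The total is dim H times a count that includes X = 0, hence nonzero. -/
lemma trace_ne_zero [FiniteDimensional ℂ H] [Nontrivial H] (hW : IsWeylSystem χ β W)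
    (h2 : (2 : k) ≠ 0) (hχ : χ ≠ 1) {e e' : Matrix ι ι k} {T S : Module.End ℂ H} (hTS : T * S = 1)
    (hT : ∀ X, T * W X = W (e * X * e') * T) : LinearMap.trace ℂ H T ≠ 0 := by
  classical
  intro h0
  have h := congrArg (· * S) (hW.sum_conj_eq_zero h0)
  have h1 (X) : W X * T * W (-X) * S =
      χ (2⁻¹ * comForm β X (-(e * X * e'))) • W (X - e * X * e') := by
    rw [mul_assoc _ T, hT, ← mul_assoc, mul_assoc _ T, hTS, mul_one, Matrix.mul_neg,
      Matrix.neg_mul, hW.mul, sub_eq_add_neg]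
  have h3 (X) : LinearMap.trace ℂ H (W X * T * W (-X) * S) =
      if Commute (X - e * X * e') β then (Module.finrank ℂ H : ℂ) else 0 := by
    rw [h1]
    split_ifs with hX
    · have : comForm β X (-(e * X * e')) = 0 := by
        have : -(e * X * e') = (X - e * X * e') + -X := by abel
        rw [this, comForm_add_right, comForm_neg_right, comForm_self, comForm_eq, hX.eq]
        simp
      rw [this, hW.central _ hX]; simp
    · rw [map_smul, hW.trace_eq_zero h2 hχ hX, smul_zero]
  simp only [Finset.sum_mul, zero_mul] at h
  have h4 := congrArg (LinearMap.trace ℂ H) h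
  rw [map_sum, Finset.sum_congr rfl fun X _ => h3 X, map_zero, Finset.sum_ite, Finset.sum_const,
    Finset.sum_const_zero, add_zero, nsmul_eq_mul, mul_eq_zero, Nat.cast_eq_zero, Nat.cast_eq_zero,
    Finset.card_eq_zero] at h4
  refine h4.elim (fun h4 => ?_) Module.finrank_pos.ne'
  exact Finset.notMem_empty 0 (h4.subset (by simp))

/-- Uniqueness in the style of Stone–von Neumann. Some average as in `sum_mul_comm` is nonzero; its
kernel is invariant, hence zero by irreducibility. -/
lemma exists_intertwiner [FiniteDimensional ℂ H] [Nontrivial H] (hW : IsWeylSystem χ β W)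
    (h2 : (2 : k) ≠ 0) (hχ : χ ≠ 1) {e e' : Matrix ι ι k} (he : e' * e = 1) (heβ : Commute e β) :
    ∃ T S : Module.End ℂ H, T * S = 1 ∧ S * T = 1 ∧ ∀ X, T * W X = W (e * X * e') * T := by
  classical
  obtain ⟨T₀, hT₀⟩ : ∃ T₀, ∑ X, W (e * X * e') * T₀ * W (-X) ≠ 0 := by
    by_contra! h
    obtain ⟨w, hw⟩ := exists_ne (0 : H)
    obtain ⟨φ, hφ⟩ : ∃ φ : Module.Dual ℂ H, φ w ≠ 0 := by
      by_contra! h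
      exact hw ((Module.forall_dual_apply_eq_zero_iff ℂ w).1 h)
    -- Test the averages on the rank-one operators φ(·) v. In the trace of the resulting relation
    -- only the X in the radical survive, each contributing φ(w) dim H ≠ 0.
    have h1 : ∑ X, φ (W (-X) w) • W (e * X * e') = 0 := by
      ext v
      have := LinearMap.congr_fun (h (φ.smulRight v)) w
      simpa [LinearMap.sum_apply] using this
    have h3 (X) : φ (W (-X) w) * LinearMap.trace ℂ H (W (e * X * e')) =
        if Commute X β then φ w * (Module.finrank ℂ H : ℂ) else 0 := by
      have hX : Commute (e * X * e') β ↔ Commute X β := by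
        have he' : e * e' = 1 := mul_eq_one_comm.1 he
        have he'β : Commute e' β := by
          calc e' * β = e' * (β * e) * e' := by rw [mul_assoc, mul_assoc, he', mul_one]
            _ = β * e' := by rw [← heβ.eq, ← mul_assoc, he, one_mul]
        refine ⟨fun h => ?_, fun h => (heβ.mul_left h).mul_left he'β⟩
        have : X = e' * (e * X * e') * e := by
          simp only [mul_assoc, he]; rw [mul_one, ← mul_assoc, he, one_mul]
        rw [this]
        exact (he'β.mul_left h).mul_left heβ
      split_ifs with h
      · rw [hW.central _ (hX.2 h), hW.central _ h.neg_left, LinearMap.trace_one]; simp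
      · rw [hW.trace_eq_zero h2 hχ (mt hX.1 h), mul_zero]
    have h4 := congrArg (LinearMap.trace ℂ H) h1
    simp only [map_sum, map_smul, smul_eq_mul, h3, map_zero] at h4
    rw [Finset.sum_ite, Finset.sum_const, Finset.sum_const_zero, add_zero, nsmul_eq_mul,
      mul_eq_zero, mul_eq_zero, Nat.cast_eq_zero, Nat.cast_eq_zero, Finset.card_eq_zero] at h4
    rcases h4 with h4 | h4 | h4
    · exact Finset.notMem_empty 0 (h4.subset (by simp))
    · exact hφ h4
    · exact Module.finrank_pos.ne' h4
  have hT := hW.sum_mul_comm he heβ T₀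
  set T := ∑ X, W (e * X * e') * T₀ * W (-X)
  have hker : LinearMap.ker T = ⊥ := by
    refine (hW.irred (LinearMap.ker T) fun X v hv => ?_).resolve_right fun h =>
      hT₀ (LinearMap.ker_eq_top.1 h)
    rw [LinearMap.mem_ker] at hv ⊢
    rw [← Module.End.mul_apply, hT, Module.End.mul_apply, hv, map_zero]
  obtain ⟨u, hu⟩ := (LinearMap.isUnit_iff_ker_eq_bot T).2 hker
  exact ⟨T, ↑u⁻¹, by rw [← hu, Units.mul_inv], by rw [← hu, Units.inv_mul], hT⟩

variable {M e e' f f' : Matrix ι ι k}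

/-- The operators `W Z` implementing the characters `X ↦ χ(tr(X M) - tr(e⁻¹ X e M))`. -/
lemma shift_mul (hW : IsWeylSystem χ β W) (h2 : (2 : k) ≠ 0) (p : k[X]) (hp : aeval β p = e)
    (he : e * e' = 1) (heβ : Commute e' β) (X : Matrix ι ι k) :
    W (-divDiff β p M * e') * W (e * X * e') =
      χ ((e * X * e' * M).trace - (X * M).trace) •
        (W (e * X * e') * W (-divDiff β p M * e')) := by
  rw [hW.conj h2]
  congr 2
  have he' : e' * e = 1 := mul_eq_one_comm.1 he
  have h := commutator_neg_divDiff_mul β M e e' p hp he heβ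
  -- The exponent is tr(e X e' (M - e M e')), whose second part collapses to tr(X M).
  rw [comForm_swap, comForm_eq, ← trace_neg, ← mul_neg, neg_sub, h, mul_sub, trace_sub]
  congr 1
  rw [mul_assoc, mul_assoc e M, ← mul_assoc e' e, he', one_mul, mul_assoc, Matrix.trace_mul_comm,
    mul_assoc, mul_assoc, he', mul_one]

/-- Write U = W(g_e) T and V = W(g_f) T₂. Moving T past W(g_f) gives the same translation operator
in both orders, by the two symmetry lemmas, so c is already the commutator scalar of T and T₂; the
nonzero trace of T then forces c = 1. -/
theorem commutator_eq_one [FiniteDimensional ℂ H] [Nontrivial H] (hW : IsWeylSystem χ β W)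
    (h2 : (2 : k) ≠ 0) (hχ : χ ≠ 1) (p q : k[X]) (hp : aeval β p = e) (hq : aeval β q = f)
    (he : e * e' = 1) (hf : f * f' = 1) (heβ : Commute e' β) (hfβ : Commute f' β)
    (hef : Commute e' f') {U V U' V' : Module.End ℂ H} (hU' : U * U' = 1) (hV' : V * V' = 1)
    (hU : ∀ X, U * W X = χ ((e * X * e' * M).trace - (X * M).trace) • (W (e * X * e') * U))
    (hV : ∀ X, V * W X = χ ((f * X * f' * M).trace - (X * M).trace) • (W (f * X * f') * V))
    {c : ℂ} (hc : U * V = c • (V * U)) : c = 1 := by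
  have aux {e e' : Matrix ι ι k} {p : k[X]} (hp : aeval β p = e) (he : e * e' = 1)
      (heβ : Commute e' β) {U U' : Module.End ℂ H} (hU' : U * U' = 1)
      (hU : ∀ X, U * W X = χ ((e * X * e' * M).trace - (X * M).trace) • (W (e * X * e') * U)) :
      ∃ T S : Module.End ℂ H, T * S = 1 ∧ U = W (-divDiff β p M * e') * T ∧
        -- Dividing U by W(g_e) removes the character from its intertwining relation.
        ∀ X, T * W X = W (e * X * e') * T := by
    have hs := hW.shift_mul (M := M) h2 p hp he heβ
    set g := -divDiff β p M * e'
    refine ⟨W (-g) * U, U' * W g, ?_, ?_, fun X => ?_⟩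
    · rw [mul_assoc, ← mul_assoc U, hU', one_mul, hW.neg_mul_self]
    · rw [← mul_assoc, hW.mul_neg_self, one_mul]
    · have h := congrArg (fun Z => W (-g) * (Z * (W (-g) * U))) (hs X)
      simp only [smul_mul_assoc, mul_smul_comm] at h
      have e1 : W (e * X * e') * W g * (W (-g) * U) = W (e * X * e') * U := by
        rw [mul_assoc, ← mul_assoc (W g), hW.mul_neg_self, one_mul]
      have e2 : W (-g) * (W g * W (e * X * e') * (W (-g) * U)) =
          W (e * X * e') * (W (-g) * U) := by
        simp only [← mul_assoc]; rw [hW.neg_mul_self, one_mul]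
      rw [e1, e2] at h
      rw [mul_assoc, hU, mul_smul_comm, h]
  obtain ⟨T, S, hTS, rfl, hT⟩ := aux hp he heβ hU' hU
  obtain ⟨T₂, S₂, hTS₂, rfl, hT₂⟩ := aux hq hf hfβ hV' hV
  have hg := neg_divDiff_cocycle_symm β M e e' f f' p q hp hq he hf hef
  have hω := comForm_neg_divDiff_symm β M e e' f f' p q hp hq (mul_eq_one_comm.1 he)
    (mul_eq_one_comm.1 hf) hef heβ hfβ
  set g := -divDiff β p M * e'
  set g₂ := -divDiff β q M * f'
  have h1 : W g * T * (W g₂ * T₂) = W g * W (e * g₂ * e') * (T * T₂) := by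
    rw [mul_assoc, ← mul_assoc T, hT]; simp only [mul_assoc]
  have h3 : W g₂ * T₂ * (W g * T) = W g * W (e * g₂ * e') * (T₂ * T) := by
    rw [hW.mul, hω, hg, ← hW.mul, mul_assoc, ← mul_assoc T₂, hT₂]; simp only [mul_assoc]
  rw [h1, h3] at hc
  have h4 := congrArg (fun Z => W (-(e * g₂ * e')) * (W (-g) * Z)) hc
  have h5 (Z : Module.End ℂ H) :
      W (-(e * g₂ * e')) * (W (-g) * (W g * W (e * g₂ * e') * Z)) = Z := by
    simp only [← mul_assoc]
    rw [mul_assoc _ _ (W g), hW.neg_mul_self, mul_one, hW.neg_mul_self, one_mul]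
  simp only [mul_smul_comm, h5] at h4
  have h6 : T = c • (T₂ * T * S₂) := by
    rw [← smul_mul_assoc, ← h4, mul_assoc, hTS₂, mul_one]
  have h7 : LinearMap.trace ℂ H T = c * LinearMap.trace ℂ H T := by
    conv_lhs => rw [h6]
    rw [map_smul, smul_eq_mul, LinearMap.trace_mul_comm, ← mul_assoc, mul_eq_one_comm.1 hTS₂,
      one_mul]
  exact (mul_right_cancel₀ (hW.trace_ne_zero h2 hχ hTS hT) (by rw [← h7, one_mul])).symm

theorem exists_projective_intertwiner [FiniteDimensional ℂ H] [Nontrivial H]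
    (hW : IsWeylSystem χ β W)
    (h2 : (2 : k) ≠ 0) (hχ : χ ≠ 1) (p : k[X]) (hp : aeval β p = e) (he : e * e' = 1)
    (heβ : Commute e' β) : ∃ U U' : Module.End ℂ H, U * U' = 1 ∧ U' * U = 1 ∧
      ∀ X, U * W X = χ ((e * X * e' * M).trace - (X * M).trace) • (W (e * X * e') * U) := by
  have he' : e' * e = 1 := mul_eq_one_comm.1 he
  have heβ' : Commute e β := by rw [← hp]; simpa using ((Commute.all X p).map (aeval β)).symm
  obtain ⟨T, S, hTS, hST, hT⟩ := hW.exists_intertwiner h2 hχ he' heβ'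
  set g := -divDiff β p M * e'
  refine ⟨W g * T, S * W (-g), ?_, ?_, fun X => ?_⟩
  · rw [mul_assoc, ← mul_assoc T, hTS, one_mul, hW.mul_neg_self]
  · rw [mul_assoc, ← mul_assoc _ _ T, hW.neg_mul_self, one_mul, hST]
  · rw [mul_assoc, hT, ← mul_assoc, hW.shift_mul h2 p hp he heβ, smul_mul_assoc]
    simp only [g, mul_assoc]

end IsWeylSystem
end Weyl

/-! ### Minimal invariant subspaces, common eigenvectors and coboundaries -/

section InvariantSubspaces

variable {ι H : Type*} [AddCommGroup H] [Module ℂ H]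

lemma exists_minimal_invariant [FiniteDimensional ℂ H] (f : ι → Module.End ℂ H)
    (p₀ : Submodule ℂ H) (hp₀ : p₀ ≠ ⊥) (hf : ∀ i, ∀ v ∈ p₀, f i v ∈ p₀) :
    ∃ p ≤ p₀, p ≠ ⊥ ∧ (∀ i, ∀ v ∈ p, f i v ∈ p) ∧
      ∀ q ≤ p, (∀ i, ∀ v ∈ q, f i v ∈ q) → q = ⊥ ∨ q = p := by
  obtain ⟨p, ⟨hp, hp', hp''⟩, hmin⟩ := wellFounded_lt.has_min
    {p : Submodule ℂ H | p ≤ p₀ ∧ p ≠ ⊥ ∧ ∀ i, ∀ v ∈ p, f i v ∈ p} ⟨p₀, le_rfl, hp₀, hf⟩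
  refine ⟨p, hp, hp', hp'', fun q hq hq' => ?_⟩
  by_contra! h
  exact hmin q ⟨hq.trans hp, h.1, hq'⟩ (lt_of_le_of_ne hq h.2)

/-- On a minimal nonzero invariant subspace each operator is scalar, because its eigenspaces there
are invariant under the others. -/
lemma exists_common_eigenvector [FiniteDimensional ℂ H] [Nontrivial H] (f : ι → Module.End ℂ H)
    (hf : ∀ i j, f i * f j = f j * f i) : ∃ v ≠ 0, ∀ i, ∃ c : ℂ, f i v = c • v := by
  obtain ⟨p, -, hp, hinv, hmin⟩ := exists_minimal_invariant f ⊤ top_ne_bot (by simp)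
  obtain ⟨v, hv, hv0⟩ := p.exists_mem_ne_zero_of_ne_bot hp
  refine ⟨v, hv0, fun i => ?_⟩
  have : Nontrivial p := Submodule.nontrivial_iff_ne_bot.2 hp
  obtain ⟨c, hc⟩ := Module.End.exists_eigenvalue ((f i).restrict (hinv i))
  obtain ⟨w, hw⟩ := hc.exists_hasEigenvector
  refine ⟨c, ?_⟩
  have hw' : f i w = c • (w : H) := congrArg Subtype.val hw.apply_eq_smul
  have h := (hmin (Module.End.eigenspace (f i) c ⊓ p) inf_le_right fun j u hu =>
    ⟨Module.End.mem_eigenspace_iff.2 ?_, hinv j u hu.2⟩).resolve_left fun h => hw.2 ?_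
  · exact Module.End.mem_eigenspace_iff.1 ((h.ge hv).1)
  · rw [← Module.End.mul_apply, hf, Module.End.mul_apply, Module.End.mem_eigenspace_iff.1 hu.1,
      map_smul]
  · exact Subtype.ext ((Submodule.mem_bot ℂ).1 (h.le ⟨Module.End.mem_eigenspace_iff.2 hw', w.2⟩))

/-- On a common eigenvector with eigenvalues d, the cocycle relation reads d(x) d(y) = c(x, y)
d(xy). -/
lemma mk_eq_one_of_commute {Γ : Type*} [Group Γ] [FiniteDimensional ℂ H] [Nontrivial H]
    (U : Γ → LinearMap.GeneralLinearGroup ℂ H) (c : Z2 Γ ℂˣ)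
    (hc : ∀ x y, (U x : Module.End ℂ H) * U y = (((c : Γ → Γ → ℂˣ) x y : ℂˣ) : ℂ) •
      (U (x * y) : Module.End ℂ H))
    (hU : ∀ x y, (U x : Module.End ℂ H) * U y = U y * U x) : (QuotientGroup.mk c : H2 Γ ℂˣ) = 1 := by
  obtain ⟨v, hv, hvU⟩ := exists_common_eigenvector (fun x => (U x : Module.End ℂ H)) hU
  choose d hd using hvU
  have hd0 (x) : d x ≠ 0 := by
    intro h
    have h1 := hd x
    rw [h, zero_smul] at h1
    apply hv
    have h3 : ((U x)⁻¹ : LinearMap.GeneralLinearGroup ℂ H).val ((U x).val v) = v := by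
      rw [← Module.End.mul_apply, Units.inv_mul, Module.End.one_apply]
    rw [← h3, h1, map_zero]
  rw [QuotientGroup.eq_one_iff, Subgroup.mem_subgroupOf]
  refine ⟨fun x => Units.mk0 (d x) (hd0 x), fun x y => Units.ext ?_⟩
  have h := LinearMap.congr_fun (hc x y) v
  rw [Module.End.mul_apply, hd, map_smul, hd, LinearMap.smul_apply, hd, smul_smul, smul_smul] at h
  have h' := smul_left_injective ℂ hv h
  simp only [Units.val_mul, Units.val_inv_eq_inv_val, Units.val_mk0]
  field_simp [hd0 (x * y)]
  exact h'.symm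

lemma isIrreducible_iff {Γ : Type*} [Group Γ] (π : Representation ℂ Γ H) :
    π.IsIrreducible ↔ Nontrivial H ∧
      ∀ p : Submodule ℂ H, (∀ g, ∀ v ∈ p, π g v ∈ p) → p = ⊥ ∨ p = ⊤ := by
  constructor
  · intro h
    refine ⟨?_, fun p hp => ?_⟩
    · obtain ⟨a, b, hab⟩ := h.toNontrivial
      by_contra h'
      rw [not_nontrivial_iff_subsingleton] at h'
      exact hab (Subrepresentation.toSubmodule_injective (Subsingleton.elim _ _))
    · rcases h.eq_bot_or_eq_top ⟨p, fun g v hv => hp g v hv⟩ with h | h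
      · exact Or.inl (congrArg Subrepresentation.toSubmodule h)
      · exact Or.inr (congrArg Subrepresentation.toSubmodule h)
  · rintro ⟨h, hp⟩
    have : Nontrivial (Subrepresentation π) :=
      ⟨⊥, ⊤, fun h => bot_ne_top (congrArg Subrepresentation.toSubmodule h)⟩
    refine ⟨fun a => ?_⟩
    rcases hp a.toSubmodule fun g v hv => a.apply_mem_toSubmodule g hv with h | h
    · exact Or.inl (Subrepresentation.toSubmodule_injective h)
    · exact Or.inr (Subrepresentation.toSubmodule_injective h)

end InvariantSubspaces

/-! ### Cyclic vectors and the centralizer of a regular matrix -/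

section Regular

open Polynomial

/-- For q the minimal polynomial this is a vector whose annihilator is as small as possible. Prime
powers are treated directly, and vectors for coprime factors are added. -/
lemma exists_forall_aeval_apply_eq_zero_iff {k V : Type*} [Field k] [AddCommGroup V] [Module k V]
    [FiniteDimensional k V] (T : Module.End k V) (q : k[X]) (hq : q ∣ minpoly k T) :
    ∃ v, ∀ p : k[X], aeval T p v = 0 ↔ q ∣ p := by
  have hm : minpoly k T ≠ 0 := minpoly.ne_zero (Algebra.IsIntegral.isIntegral T)
  have hmul (p q : k[X]) (v : V) : aeval T (p * q) v = aeval T p (aeval T q v) := by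
    rw [map_mul, Module.End.mul_apply]
  induction q using UniqueFactorizationMonoid.induction_on_coprime with
  | h0 => exact absurd (zero_dvd_iff.1 hq) hm
  | h1 hu => exact ⟨0, fun p => by simp [hu.dvd]⟩
  | @hpr r i hr =>
    rcases i with _ | i
    · exact ⟨0, fun p => by simp⟩
    obtain ⟨c, hc⟩ := hq
    have h1 : aeval T (r ^ i * c) ≠ 0 := by
      intro h
      have h2 : r ^ (i + 1) * c ∣ r ^ i * c := hc ▸ minpoly.dvd k T h
      have hc0 : c ≠ 0 := by rintro rfl; simp [hm] at hc
      have h3 := (mul_dvd_mul_iff_right hc0).1 h2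
      exact absurd ((pow_dvd_pow_iff hr.ne_zero hr.not_isUnit).1 h3) (by omega)
    obtain ⟨w, hw⟩ : ∃ w, aeval T (r ^ i * c) w ≠ 0 := by
      by_contra! h
      exact h1 (LinearMap.ext h)
    have h4 : aeval T (r ^ (i + 1)) (aeval T c w) = 0 := by
      rw [← hmul, ← hc, minpoly.aeval, LinearMap.zero_apply]
    refine ⟨aeval T c w, fun p => ⟨fun hp => ?_, ?_⟩⟩
    -- By Bézout the gcd of p and r^(i+1) also kills the vector. It is associated to a power of r,
    -- and a power of exponent at most i would contradict the choice of w.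
    · obtain ⟨g, hgp, hgr, x, y, hxy⟩ : ∃ g, g ∣ p ∧ g ∣ r ^ (i + 1) ∧
          ∃ x y, g = x * p + y * r ^ (i + 1) := by
        classical
        exact ⟨_, EuclideanDomain.gcd_dvd_left p _, EuclideanDomain.gcd_dvd_right p _, _, _,
          (EuclideanDomain.gcd_eq_gcd_ab _ _).trans (by rw [mul_comm p, mul_comm (r ^ (i + 1))])⟩
      obtain ⟨j, hj, hj'⟩ := (dvd_prime_pow hr _).1 hgr
      have h5 : aeval T g (aeval T c w) = 0 := by
        rw [hxy, map_add, LinearMap.add_apply, hmul, hmul, hp, h4, map_zero, map_zero, add_zero]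
      rcases hj.lt_or_eq with hlt | rfl
      · exfalso
        obtain ⟨z, hz⟩ : g ∣ r ^ i := hj'.dvd.trans (pow_dvd_pow r (by omega))
        apply hw
        rw [hmul, hz, mul_comm, hmul, h5, map_zero]
      · exact hj'.symm.dvd.trans hgp
    · rintro ⟨z, rfl⟩
      rw [mul_comm, hmul, h4, map_zero]
  | @hcp x y hxy ihx ihy =>
    obtain ⟨v, hv⟩ := ihx ((dvd_mul_right _ _).trans hq)
    obtain ⟨w, hw⟩ := ihy ((dvd_mul_left _ _).trans hq)
    have hxy' : IsCoprime x y := isRelPrime_iff_isCoprime.1 hxy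
    refine ⟨v + w, fun p => ⟨fun hp => ?_, ?_⟩⟩
    · rw [map_add] at hp
      refine hxy'.mul_dvd ?_ ?_
      · refine hxy'.dvd_of_dvd_mul_left ((hv _).1 ?_)
        rw [hmul, eq_neg_of_add_eq_zero_left hp, map_neg, ← hmul, mul_comm, hmul,
          (hw y).2 dvd_rfl, map_zero, neg_zero]
      · refine hxy'.symm.dvd_of_dvd_mul_left ((hw _).1 ?_)
        rw [hmul, eq_neg_of_add_eq_zero_right hp, map_neg, ← hmul, mul_comm, hmul,
          (hv x).2 dvd_rfl, map_zero, neg_zero]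
    · intro h
      rw [map_add, (hv p).2 ((dvd_mul_right _ _).trans h), (hw p).2 ((dvd_mul_left _ _).trans h),
        add_zero]

/-- Since the minimal polynomial has degree n, a vector v with that annihilator is cyclic. Choose p
with B v = p(A) v; then B and p(A) agree on every q(A) v. -/
lemma IsRegular.exists_aeval_eq {k : Type*} [Field k] {n : ℕ} {A : Matrix (Fin n) (Fin n) k}
    (hA : IsRegular A) {B : Matrix (Fin n) (Fin n) k} (hB : Commute B A) :
    ∃ p : k[X], aeval A p = B := by
  set T := Matrix.toLinAlgEquiv' A
  set S := Matrix.toLinAlgEquiv' B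
  have hST : Commute S T := hB.map Matrix.toLinAlgEquiv'
  have hm : minpoly k T = minpoly k A := minpoly.algEquiv_eq Matrix.toLinAlgEquiv' A
  obtain ⟨v, hv⟩ := exists_forall_aeval_apply_eq_zero_iff T _ dvd_rfl
  have hdeg : (minpoly k T).degree = n := by
    rw [hm, ← hA, Matrix.charpoly_degree_eq_dim, Fintype.card_fin]
  let Φ : degreeLT k n →ₗ[k] (Fin n → k) :=
    (LinearMap.applyₗ v ∘ₗ (aeval T).toLinearMap) ∘ₗ (degreeLT k n).subtype
  have hinj : Function.Injective Φ := by
    rw [← LinearMap.ker_eq_bot, LinearMap.ker_eq_bot']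
    intro p hp
    have h1 : minpoly k T ∣ p := (hv _).1 hp
    exact Subtype.ext (eq_zero_of_dvd_of_degree_lt h1 (hdeg ▸ mem_degreeLT.1 p.2))
  have hsurj : Function.Surjective Φ := by
    have : Module.Finite k (degreeLT k n) := Module.Finite.equiv (degreeLTEquiv k n).symm
    refine (LinearMap.injective_iff_surjective_of_finrank_eq_finrank ?_).1 hinj
    exact (degreeLTEquiv k n).finrank_eq
  obtain ⟨p, hp⟩ := hsurj (S v)
  have hp : aeval T (p : k[X]) v = S v := hp
  refine ⟨p, Matrix.toLinAlgEquiv'.injective ?_⟩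
  have hT (q : k[X]) : Matrix.toLinAlgEquiv' (aeval A q) = aeval T q :=
    (aeval_algHom_apply (Matrix.toLinAlgEquiv' : _ ≃ₐ[k] _).toAlgHom A q).symm
  have hc (q r : k[X]) : Commute (aeval T q) (aeval T r) := (Commute.all q r).map (aeval T)
  rw [hT]
  refine LinearMap.ext fun u => ?_
  obtain ⟨q, hq⟩ := hsurj u
  have hq : aeval T (q : k[X]) v = u := hq
  have hS : Commute S (aeval T (q : k[X])) := by
    rw [aeval_eq_sum_range]
    exact Commute.sum_right _ _ _ fun i _ => (hST.pow_right i).smul_right _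
  change aeval T (p : k[X]) u = S u
  rw [← hq, ← Module.End.mul_apply, (hc _ _).eq, Module.End.mul_apply, hp,
    ← Module.End.mul_apply, ← hS.eq, Module.End.mul_apply]

end Regular

/-! ### Additive characters of finite vector spaces -/

section Characters

/-- Self-duality of finite vector spaces: φ ↦ χ ∘ φ is injective from the linear dual of A to its
character group, and both have |A| elements. Functionals then extend from A to E. -/
lemma exists_linearMap_of_addChar {k E : Type*} [Field k] [Finite k] [AddCommGroup E] [Module k E]
    [FiniteDimensional k E] (χ : AddChar k ℂ) (hχ : χ ≠ 1) (A : Submodule k E) (f : AddChar A ℂ) :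
    ∃ φ : E →ₗ[k] k, ∀ a : A, f a = χ (φ a) := by
  have : Finite E := Module.finite_of_finite k
  let Φ (φ : Module.Dual k A) : AddChar A ℂ := χ.compAddMonoidHom φ.toAddMonoidHom
  have hinj : Function.Injective Φ := by
    intro φ φ' h
    by_contra hne
    obtain ⟨a, ha⟩ : ∃ a, (φ - φ') a ≠ 0 := by
      by_contra! h'
      exact hne (sub_eq_zero.1 (LinearMap.ext h'))
    refine hχ (DFunLike.ext _ _ fun x => ?_)
    have h1 : χ (φ ((x / (φ - φ') a) • a)) = χ (φ' ((x / (φ - φ') a) • a)) :=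
      DFunLike.congr_fun h ((x / (φ - φ') a) • a)
    have h3 : x = φ ((x / (φ - φ') a) • a) - φ' ((x / (φ - φ') a) • a) := by
      rw [← LinearMap.sub_apply, map_smul, smul_eq_mul, div_mul_cancel₀ _ ha]
    rw [h3, AddChar.map_sub_eq_div, h1, div_self ((AddChar.val_isUnit χ _).ne_zero),
      AddChar.one_apply]
  have : Finite (Module.Dual k A) := Module.finite_of_finite k
  have hcard : Nat.card (Module.Dual k A) = Nat.card (AddChar A ℂ) := by
    have := Fintype.ofFinite A
    rw [Module.natCard_eq_pow_finrank (K := k), Subspace.dual_finrank_eq,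
      ← Module.natCard_eq_pow_finrank, Nat.card_eq_fintype_card, Nat.card_eq_fintype_card,
      AddChar.card_eq]
  obtain ⟨φ, hφ⟩ := ((Nat.bijective_iff_injective_and_card Φ).2 ⟨hinj, hcard⟩).2 f
  obtain ⟨ψ, hψ⟩ := φ.exists_extend
  refine ⟨ψ, fun a => ?_⟩
  rw [← hφ, ← hψ]; rfl

lemma exists_trace_mul_eq {k ι : Type*} [CommRing k] [Fintype ι] [DecidableEq ι]
    (φ : Matrix ι ι k →ₗ[k] k) : ∃ M : Matrix ι ι k, ∀ X, φ X = (X * M).trace := by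
  refine ⟨Matrix.of fun i j => φ (Matrix.single j i 1), fun X => ?_⟩
  conv_lhs => rw [Matrix.matrix_eq_sum_single X]
  simp only [map_sum, Matrix.trace, Matrix.diag, Matrix.mul_apply, Matrix.of_apply]
  refine Finset.sum_congr rfl fun i _ => Finset.sum_congr rfl fun j _ => ?_
  rw [← mul_one (X i j), ← smul_eq_mul, ← Matrix.smul_single, map_smul, smul_eq_mul, smul_eq_mul,
    mul_one]

end Characters

/-! ### Exponential coordinates on K_{l-1} -/

section Congruence

variable {F : Type*} [Field F] [ValuativeRel F] {n : ℕ}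

lemma redMod_add_smul {ϖ : 𝒪[F]} (hϖ : Irreducible ϖ) {r : ℕ} {c : 𝒪[F]} (hc : ϖ ^ r ∣ c)
    (X Z : Matrix (Fin n) (Fin n) 𝒪[F]) : redMod r (X + c • Z) = redMod r X := by
  ext i j
  simp only [Matrix.map_apply, Matrix.add_apply, Matrix.smul_apply, smul_eq_mul]
  rw [Ideal.Quotient.eq, add_sub_cancel_left]
  obtain ⟨d, rfl⟩ := hc
  exact Ideal.mul_mem_right _ _ (Ideal.mul_mem_right _ _
    (Ideal.pow_mem_pow ((IsLocalRing.mem_maximalIdeal _).2 hϖ.not_isUnit) r))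

lemma exists_eq_add_smul [IsDiscreteValuationRing 𝒪[F]] {ϖ : 𝒪[F]} (hϖ : Irreducible ϖ) {r : ℕ}
    {X Y : Matrix (Fin n) (Fin n) 𝒪[F]} (h : ∀ i j, X i j - Y i j ∈ 𝓂[F] ^ r) :
    ∃ Z, X = Y + ϖ ^ r • Z := by
  rw [hϖ.maximalIdeal_eq, Ideal.span_singleton_pow] at h
  simp only [Ideal.mem_span_singleton] at h
  choose Z hZ using h
  refine ⟨Matrix.of Z, Matrix.ext fun i j => ?_⟩
  simp only [Matrix.add_apply, Matrix.smul_apply, smul_eq_mul, Matrix.of_apply]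
  rw [← hZ]; ring

lemma exists_eq_add_smul_of_redMod_eq [IsDiscreteValuationRing 𝒪[F]] {ϖ : 𝒪[F]}
    (hϖ : Irreducible ϖ) {r : ℕ} {X Y : Matrix (Fin n) (Fin n) 𝒪[F]}
    (h : redMod r X = redMod r Y) : ∃ Z, X = Y + ϖ ^ r • Z :=
  exists_eq_add_smul hϖ fun i j => Ideal.Quotient.eq.1 (congrFun (congrFun h i) j)

lemma exists_eq_add_smul_of_residueMat_eq [IsDiscreteValuationRing 𝒪[F]] {ϖ : 𝒪[F]}
    (hϖ : Irreducible ϖ) {X Y : Matrix (Fin n) (Fin n) 𝒪[F]}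
    (h : residueMat X = residueMat Y) : ∃ Z, X = Y + ϖ • Z := by
  have := exists_eq_add_smul (r := 1) hϖ (X := X) (Y := Y) fun i j => by
    rw [pow_one]; exact Ideal.Quotient.eq.1 (congrFun (congrFun h i) j)
  simpa using this

lemma redMod_one (r : ℕ) : redMod r (1 : Matrix (Fin n) (Fin n) 𝒪[F]) = 1 :=
  Matrix.map_one _ (map_zero _) (map_one _)

lemma residueMat_one : residueMat (1 : Matrix (Fin n) (Fin n) 𝒪[F]) = 1 :=
  Matrix.map_one _ (map_zero _) (map_one _)

lemma residueMat_mul (X Y : Matrix (Fin n) (Fin n) 𝒪[F]) :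
    residueMat (X * Y) = residueMat X * residueMat Y := Matrix.map_mul

lemma residueMat_add (X Y : Matrix (Fin n) (Fin n) 𝒪[F]) :
    residueMat (X + Y) = residueMat X + residueMat Y := Matrix.map_add _ (map_add _) _ _

lemma residueMat_sub (X Y : Matrix (Fin n) (Fin n) 𝒪[F]) :
    residueMat (X - Y) = residueMat X - residueMat Y := Matrix.map_sub _ (map_sub _) _ _

lemma residueMat_smul (c : 𝒪[F]) (X : Matrix (Fin n) (Fin n) 𝒪[F]) :
    residueMat (c • X) = IsLocalRing.residue 𝒪[F] c • residueMat X := by ext; simp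

lemma trace_residueMat (X : Matrix (Fin n) (Fin n) 𝒪[F]) :
    (residueMat X).trace = IsLocalRing.residue 𝒪[F] X.trace := by
  simp [Matrix.trace]

lemma residueMat_surjective (x : Matrix (Fin n) (Fin n) 𝓀[F]) :
    ∃ X : Matrix (Fin n) (Fin n) 𝒪[F], residueMat X = x := by
  choose g hg using IsLocalRing.residue_surjective (R := 𝒪[F])
  exact ⟨x.map g, by ext i j; simp [hg]⟩

/-- The truncated exponential `1 + ϖ^{l-1} X + ϖ^{2l-2} X² / 2`, where `h` stands for `1 / 2`. -/
def expMat (ϖ h : 𝒪[F]) (l : ℕ) (X : Matrix (Fin n) (Fin n) 𝒪[F]) : Matrix (Fin n) (Fin n) 𝒪[F] :=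
  1 + ϖ ^ (l - 1) • X + (h * (ϖ ^ (l - 1) * ϖ ^ (l - 1))) • (X * X)

variable {ϖ h : 𝒪[F]} (hϖ : Irreducible ϖ) (hh : 2 * h = 1) {l : ℕ} (hl : 2 ≤ l)

include hl in
lemma pow_dvd_pow_mul_self_mul {c : 𝒪[F]} (hc : ϖ ∣ c) :
    ϖ ^ (2 * l - 1) ∣ ϖ ^ (l - 1) * ϖ ^ (l - 1) * c := by
  obtain ⟨d, rfl⟩ := hc
  rw [← mul_assoc, ← pow_add, ← pow_succ]
  exact Dvd.dvd.mul_right (pow_dvd_pow _ (by omega)) _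

include hl in
lemma dvd_pow_pred : ϖ ∣ ϖ ^ (l - 1) := dvd_pow_self _ (by omega)

include hϖ hl in
-- Only X mod 𝔭^l matters, since (l - 1) + l = r.
lemma redMod_expMat_add_smul {c : 𝒪[F]} (hc : ϖ ^ l ∣ c) (X Z : Matrix (Fin n) (Fin n) 𝒪[F]) :
    redMod (2 * l - 1) (expMat ϖ h l (X + c • Z)) = redMod (2 * l - 1) (expMat ϖ h l X) := by
  have hd : ϖ ^ (2 * l - 1) ∣ ϖ ^ (l - 1) * c := by
    refine dvd_trans ?_ (mul_dvd_mul_left _ hc)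
    rw [← pow_add]; exact pow_dvd_pow _ (by omega)
  have : expMat ϖ h l (X + c • Z) = expMat ϖ h l X + (ϖ ^ (l - 1) * c) •
      (Z + (h * ϖ ^ (l - 1)) • (X * Z + Z * X + c • (Z * Z))) := by
    simp only [expMat, mul_add, add_mul, Matrix.smul_mul, Matrix.mul_smul, smul_add, smul_smul]
    module
  rw [this, redMod_add_smul hϖ hd]

include hϖ hh hl in
-- Baker–Campbell–Hausdorff stops after the first commutator: terms cubic in ϖ^{l-1} vanish because
-- 3(l - 1) ≥ 2l - 1 for l ≥ 2.
lemma redMod_expMat_mul (X Y : Matrix (Fin n) (Fin n) 𝒪[F]) :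
    redMod (2 * l - 1) (expMat ϖ h l X * expMat ϖ h l Y) =
      redMod (2 * l - 1) (expMat ϖ h l (X + Y + (h * ϖ ^ (l - 1)) • (X * Y - Y * X))) := by
  have : expMat ϖ h l X * expMat ϖ h l Y =
      expMat ϖ h l (X + Y + (h * ϖ ^ (l - 1)) • (X * Y - Y * X)) +
        (ϖ ^ (l - 1) * ϖ ^ (l - 1) * ϖ ^ (l - 1)) •
          (h • (X * X * Y + X * (Y * Y)) + (h * h * ϖ ^ (l - 1)) • (X * X * (Y * Y))
            - (h * h) • ((X + Y) * (X * Y - Y * X) + (X * Y - Y * X) * (X + Y))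
            - (h * h * h * ϖ ^ (l - 1)) • ((X * Y - Y * X) * (X * Y - Y * X))) := by
    simp only [expMat]
    generalize ϖ ^ (l - 1) = a
    simp only [mul_add, add_mul, mul_sub, sub_mul, Matrix.smul_mul, Matrix.mul_smul,
      smul_add, smul_sub, smul_smul, one_mul, mul_one, mul_assoc]
    match_scalars <;> first | ring1 | linear_combination (-a * a) * hh
  rw [this, redMod_add_smul hϖ (pow_dvd_pow_mul_self_mul hl (dvd_pow_pred hl))]

include hϖ hh hl in
lemma redMod_expMat_mul_neg (X : Matrix (Fin n) (Fin n) 𝒪[F]) :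
    redMod (2 * l - 1) (expMat ϖ h l X) * redMod (2 * l - 1) (expMat ϖ h l (-X)) = 1 := by
  rw [← map_redMod_mul, redMod_expMat_mul hϖ hh hl, ← redMod_one]
  simp [expMat]

/-- The element `1 + ϖ^{l-1} X + ϖ^{2l-2} X² / 2 mod 𝔭^r` of `K_{l-1}`. -/
def expK (X : Matrix (Fin n) (Fin n) 𝒪[F]) : Kpred F n l :=
  ⟨⟨redMod (2 * l - 1) (expMat ϖ h l X), redMod (2 * l - 1) (expMat ϖ h l (-X)),
    redMod_expMat_mul_neg hϖ hh hl X, by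
      simpa using redMod_expMat_mul_neg hϖ hh hl (-X)⟩, by
    refine (MonoidHom.mem_ker).2 (Units.ext (Matrix.ext fun i j => ?_))
    have h1 : ϖ ^ (l - 1) ∈ 𝓂[F] ^ (l - 1) :=
      Ideal.pow_mem_pow (I := 𝓂[F]) ((IsLocalRing.mem_maximalIdeal _).2 hϖ.not_isUnit) _
    change Ideal.Quotient.factor (Ideal.pow_le_pow_right (by omega))
      (Ideal.Quotient.mk (𝓂[F] ^ (2 * l - 1)) (expMat ϖ h l X i j)) =
      (1 : Matrix (Fin n) (Fin n) (ResRing F (l - 1))) i j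
    rw [Ideal.Quotient.factor_mk]
    refine Eq.trans (Ideal.Quotient.eq.2 ?_)
      (congrFun (congrFun (redMod_one (F := F) (n := n) (l - 1)) i) j)
    have : expMat ϖ h l X i j - (1 : Matrix (Fin n) (Fin n) 𝒪[F]) i j =
        ϖ ^ (l - 1) * (X i j + h * ϖ ^ (l - 1) * (X * X) i j) := by
      simp only [expMat, Matrix.add_apply, Matrix.smul_apply, smul_eq_mul]; ring
    rw [this]
    exact Ideal.mul_mem_right _ _ h1⟩

lemma expK_val (X : Matrix (Fin n) (Fin n) 𝒪[F]) :
    ((expK hϖ hh hl X : G F n (2 * l - 1)) : Matrix (Fin n) (Fin n) (ResRing F (2 * l - 1))) =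
      redMod (2 * l - 1) (expMat ϖ h l X) := rfl

lemma expK_mul (X Y : Matrix (Fin n) (Fin n) 𝒪[F]) :
    expK hϖ hh hl X * expK hϖ hh hl Y =
      expK hϖ hh hl (X + Y + (h * ϖ ^ (l - 1)) • (X * Y - Y * X)) := by
  refine Subtype.ext (Units.ext ?_)
  rw [expK_val, ← redMod_expMat_mul hϖ hh hl, map_redMod_mul]; rfl

lemma expK_add_smul {c : 𝒪[F]} (hc : ϖ ^ l ∣ c) (X Z : Matrix (Fin n) (Fin n) 𝒪[F]) :
    expK hϖ hh hl (X + c • Z) = expK hϖ hh hl X :=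
  Subtype.ext (Units.ext (redMod_expMat_add_smul hϖ hl hc X Z))

include hϖ hl in
-- The argument on the left is the truncated logarithm, so the exponential is onto K_{l-1}.
lemma expMat_sub_sq (Y : Matrix (Fin n) (Fin n) 𝒪[F]) :
    redMod (2 * l - 1) (expMat ϖ h l (Y - (h * ϖ ^ (l - 1)) • (Y * Y))) =
      redMod (2 * l - 1) (1 + ϖ ^ (l - 1) • Y) := by
  have : expMat ϖ h l (Y - (h * ϖ ^ (l - 1)) • (Y * Y)) = 1 + ϖ ^ (l - 1) • Y +
      (ϖ ^ (l - 1) * ϖ ^ (l - 1) * ϖ ^ (l - 1)) • ((h * h * (h * ϖ ^ (l - 1))) • (Y * Y * (Y * Y))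
        - (h * h) • (Y * (Y * Y) + Y * (Y * Y))) := by
    simp only [expMat]
    generalize ϖ ^ (l - 1) = a
    simp only [mul_sub, sub_mul, Matrix.smul_mul, Matrix.mul_smul, smul_add, smul_sub, smul_smul,
      mul_assoc]
    module
  rw [this, redMod_add_smul hϖ (pow_dvd_pow_mul_self_mul hl (dvd_pow_pred hl))]

lemma exists_expK_eq_of_val (k : Kpred F n l) (Y : Matrix (Fin n) (Fin n) 𝒪[F])
    (hk : ((k : G F n (2 * l - 1)) : Matrix (Fin n) (Fin n) (ResRing F (2 * l - 1))) =
      redMod (2 * l - 1) (1 + ϖ ^ (l - 1) • Y)) :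
    ∃ X, residueMat X = residueMat Y ∧ expK hϖ hh hl X = k := by
  refine ⟨Y - (h * ϖ ^ (l - 1)) • (Y * Y), ?_, Subtype.ext (Units.ext ?_)⟩
  · rw [residueMat_sub, residueMat_smul,
      (IsLocalRing.residue_eq_zero_iff _).2, zero_smul, sub_zero]
    exact Ideal.mul_mem_left _ _ (Ideal.mem_of_dvd _ (dvd_pow_pred hl)
      ((IsLocalRing.mem_maximalIdeal _).2 hϖ.not_isUnit))
  · rw [hk, expK_val, expMat_sub_sq hϖ hl]

lemma exists_expK_eq [IsDiscreteValuationRing 𝒪[F]] (k : Kpred F n l) :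
    ∃ X, expK hϖ hh hl X = k := by
  obtain ⟨Z, hZ⟩ := exists_redMod ((k : G F n (2 * l - 1)) :
    Matrix (Fin n) (Fin n) (ResRing F (2 * l - 1)))
  obtain ⟨Y, hY⟩ : ∃ Y, Z = 1 + ϖ ^ (l - 1) • Y := by
    refine exists_eq_add_smul_of_redMod_eq hϖ ?_
    have h1 := congrArg Units.val (MonoidHom.mem_ker.1 k.2)
    ext i j
    have h3 := congrFun (congrFun h1 i) j
    change Ideal.Quotient.factor (Ideal.pow_le_pow_right (by omega)) (((k : G F n (2 * l - 1)) :
      Matrix (Fin n) (Fin n) (ResRing F (2 * l - 1))) i j) = _ at h3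
    rw [← hZ] at h3
    change Ideal.Quotient.mk (𝓂[F] ^ (l - 1)) (Z i j) = _ at h3
    exact h3.trans (congrFun (congrFun (redMod_one (F := F) (n := n) (l - 1)) i) j).symm
  obtain ⟨X, -, hX⟩ := exists_expK_eq_of_val hϖ hh hl k Y (by rw [← hZ, hY])
  exact ⟨X, hX⟩

lemma conj_expK [IsDiscreteValuationRing 𝒪[F]] (ε : G F n (2 * l - 1))
    {E E' : Matrix (Fin n) (Fin n) 𝒪[F]}
    (hE : redMod (2 * l - 1) E = ε) (hE' : redMod (2 * l - 1) E' = (ε⁻¹ : G F n (2 * l - 1)))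
    (X : Matrix (Fin n) (Fin n) 𝒪[F]) :
    MulAut.conjNormal ε (expK hϖ hh hl X) = expK hϖ hh hl (E * X * E') := by
  refine Subtype.ext (Units.ext ?_)
  have h1 : redMod (2 * l - 1) (E * E') = 1 := by
    rw [map_redMod_mul, hE, hE', Units.mul_inv]
  have h2 : redMod (2 * l - 1) (E' * E) = 1 := by
    rw [map_redMod_mul, hE, hE', Units.inv_mul]
  rw [expK_val, MulAut.conjNormal_apply, Units.val_mul, Units.val_mul, expK_val, ← hE, ← hE',
    ← map_redMod_mul, ← map_redMod_mul]
  have h3 (c : 𝒪[F]) (T : Matrix (Fin n) (Fin n) 𝒪[F]) :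
      redMod (2 * l - 1) (c • T) = Ideal.Quotient.mk (𝓂[F] ^ (2 * l - 1)) c • redMod (2 * l - 1) T := by
    ext; simp
  have h4 (S T : Matrix (Fin n) (Fin n) 𝒪[F]) :
      redMod (2 * l - 1) (S + T) = redMod (2 * l - 1) S + redMod (2 * l - 1) T :=
    Matrix.map_add _ (map_add _) _ _
  have h5 : redMod (2 * l - 1) (E * X * E' * (E * X * E')) =
      redMod (2 * l - 1) (E * (X * X) * E') := by
    have : E * X * E' * (E * X * E') = E * X * (E' * E) * (X * E') := by simp only [mul_assoc]
    rw [this, map_redMod_mul, map_redMod_mul _ (E * X), h2, mul_one, ← map_redMod_mul]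
    simp only [mul_assoc]
  simp only [expMat, mul_add, add_mul, Matrix.mul_smul, Matrix.smul_mul, mul_one, h4, h3, h5, h1,
    redMod_one]

end Congruence

/-! ### The additive character Ψ attached to ψ -/

section Extension

open Polynomial

variable {F : Type*} [Field F] [ValuativeRel F] {n : ℕ}

lemma mem_resAlg_iff {β : Matrix (Fin n) (Fin n) 𝒪[F]} (hβ : IsRegular (residueMat β))
    (x : Matrix (Fin n) (Fin n) 𝓀[F]) : x ∈ resAlg β ↔ Commute x (residueMat β) := by
  change x ∈ Algebra.adjoin 𝓀[F] {residueMat β} ↔ _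
  rw [Algebra.adjoin_singleton_eq_range_aeval]
  constructor
  · rintro ⟨p, rfl⟩
    simpa using ((Commute.all p X).map (aeval (residueMat β)))
  · intro h
    obtain ⟨p, hp⟩ := hβ.exists_aeval_eq h
    exact ⟨p, hp⟩

variable {ϖ h : 𝒪[F]} (hϖ : Irreducible ϖ) (hh : 2 * h = 1) {l : ℕ} (hl : 2 ≤ l)
  {β : Matrix (Fin n) (Fin n) 𝒪[F]}

include hϖ in
lemma residue_uniformizer : IsLocalRing.residue 𝒪[F] ϖ = 0 :=
  (IsLocalRing.residue_eq_zero_iff _).2 ((IsLocalRing.mem_maximalIdeal _).2 hϖ.not_isUnit)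

lemma expK_mem {Z : Matrix (Fin n) (Fin n) 𝒪[F]} (hZ : residueMat Z ∈ resAlg β) :
    expK hϖ hh hl Z ∈ KpredBeta ϖ hϖ l hl β := by
  refine ⟨Z + (h * ϖ ^ (l - 1)) • (Z * Z), ?_, ?_⟩
  · rw [expK_val, expMat, smul_add, smul_smul, mul_left_comm, add_assoc]
  · rwa [residueMat_add, residueMat_smul, map_mul, map_pow, residue_uniformizer hϖ, zero_pow
      (by omega), mul_zero, zero_smul, add_zero]

/-- The element `1 + ϖ^{l-1} Z + ϖ^{2l-2} Z² / 2 mod 𝔭^r` of `K_{l-1}(𝔽[β̄])`. -/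
def expKBeta (Z : Matrix (Fin n) (Fin n) 𝒪[F]) (hZ : residueMat Z ∈ resAlg β) :
    KpredBeta ϖ hϖ l hl β := ⟨expK hϖ hh hl Z, expK_mem hϖ hh hl hZ⟩

lemma exists_expKBeta_eq (z : KpredBeta ϖ hϖ l hl β) :
    ∃ Z hZ, expKBeta hϖ hh hl Z hZ = z := by
  obtain ⟨z, X, hX, hX'⟩ := z
  obtain ⟨Z, hZ, hZ'⟩ := exists_expK_eq_of_val hϖ hh hl z X hX
  exact ⟨Z, hZ ▸ hX', Subtype.ext hZ'⟩

section Tau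

variable (τ : AddChar F Circle) (hτ : {x : F | ∀ y : 𝒪[F], τ (x * y) = 1} = {x : F | x ∈ 𝒪[F]})

include hτ in
lemma tau_integer (x : 𝒪[F]) : τ x = 1 := by
  have h1 : (x : F) ∈ {x : F | ∀ y : 𝒪[F], τ (x * y) = 1} := by rw [hτ]; exact x.2
  simpa using h1 1

include hτ in
-- τ is trivial on O, so x ↦ τ(ϖ⁻¹ x) factors through 𝔽; if it were trivial, ϖ⁻¹ would lie in O.
lemma exists_residue_addChar [IsDiscreteValuationRing 𝒪[F]] (hϖ : Irreducible ϖ) :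
    ∃ χ : AddChar 𝓀[F] ℂ, χ ≠ 1 ∧
      ∀ x : 𝒪[F], χ (IsLocalRing.residue 𝒪[F] x) = (τ ((ϖ : F)⁻¹ * x) : ℂ) := by
  have hϖ0 : (ϖ : F) ≠ 0 := fun h => hϖ.ne_zero (Subtype.ext h)
  have key (x y : 𝒪[F]) (hxy : IsLocalRing.residue 𝒪[F] x = IsLocalRing.residue 𝒪[F] y) :
      τ ((ϖ : F)⁻¹ * x) = τ ((ϖ : F)⁻¹ * y) := by
    have h1 : x - y ∈ 𝓂[F] := Ideal.Quotient.eq.1 hxy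
    rw [hϖ.maximalIdeal_eq, Ideal.mem_span_singleton] at h1
    obtain ⟨z, hz⟩ := h1
    have : (ϖ : F)⁻¹ * x = (ϖ : F)⁻¹ * y + (z : F) := by
      have h3 : (x : F) = y + ϖ * z := by
        have := congrArg (Subtype.val) hz
        push_cast at this
        rw [← this]; ring
      rw [h3]; field_simp
    rw [this, AddChar.map_add_eq_mul, tau_integer τ hτ, mul_one]
  obtain ⟨s, hs⟩ := (IsLocalRing.residue_surjective (R := 𝒪[F])).hasRightInverse
  let χ : AddChar 𝓀[F] ℂ :=
    { toFun := fun x => (τ ((ϖ : F)⁻¹ * s x) : ℂ)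
      map_zero_eq_one' := by
        rw [key (s 0) 0 (by rw [hs, map_zero])]; simp
      map_add_eq_mul' := fun x y => by
        rw [key (s (x + y)) (s x + s y) (by rw [map_add, hs, hs, hs])]
        push_cast
        rw [mul_add, AddChar.map_add_eq_mul, Circle.coe_mul] }
  have hχ (x : 𝒪[F]) : χ (IsLocalRing.residue 𝒪[F] x) = (τ ((ϖ : F)⁻¹ * x) : ℂ) :=
    congrArg ((↑) : Circle → ℂ) (key _ _ (hs _))
  refine ⟨χ, fun h1 => ?_, hχ⟩
  have h3 : (ϖ : F)⁻¹ ∈ {x : F | x ∈ 𝒪[F]} := by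
    rw [← hτ]
    intro y
    apply Circle.ext
    rw [← hχ, h1]; simp
  exact hϖ.not_isUnit (isUnit_iff_exists_inv.2 ⟨⟨_, h3⟩, Subtype.ext (mul_inv_cancel₀ hϖ0)⟩)

/-- The character `X ↦ τ(ϖ^{-l} tr(X β))`. -/
def traceChar (ϖ : 𝒪[F]) (l : ℕ) (β X : Matrix (Fin n) (Fin n) 𝒪[F]) : ℂ :=
  (τ (((ϖ : F) ^ l)⁻¹ * ((X * β).trace : 𝒪[F])) : ℂ)

lemma traceChar_add (X Y : Matrix (Fin n) (Fin n) 𝒪[F]) :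
    traceChar τ ϖ l β (X + Y) = traceChar τ ϖ l β X * traceChar τ ϖ l β Y := by
  simp only [traceChar]
  rw [add_mul, Matrix.trace_add, Subring.coe_add, mul_add, AddChar.map_add_eq_mul, Circle.coe_mul]

lemma traceChar_ne_zero (X : Matrix (Fin n) (Fin n) 𝒪[F]) : traceChar τ ϖ l β X ≠ 0 :=
  Circle.coe_ne_zero _

include hϖ in
lemma traceChar_smul {m : ℕ} (hm : m ≤ l) (X : Matrix (Fin n) (Fin n) 𝒪[F]) :
    traceChar τ ϖ l β (ϖ ^ m • X) =
      (τ (((ϖ : F) ^ (l - m))⁻¹ * ((X * β).trace : 𝒪[F])) : ℂ) := by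
  have hϖ0 : (ϖ : F) ≠ 0 := fun h => hϖ.ne_zero (Subtype.ext h)
  rw [traceChar, Matrix.smul_mul, Matrix.trace_smul]
  obtain ⟨k, rfl⟩ := Nat.exists_eq_add_of_le hm
  rw [Nat.add_sub_cancel_left, smul_eq_mul, Subring.coe_mul, Subring.coe_pow, pow_add, mul_comm
    ((ϖ : F) ^ m), mul_inv, mul_assoc, inv_mul_cancel_left₀ (pow_ne_zero _ hϖ0)]

include hϖ hτ in
-- E' β E ≡ β mod 𝔭^r, and r ≥ l makes the error integral after division by ϖ^l.
lemma traceChar_conj [IsDiscreteValuationRing 𝒪[F]] {r : ℕ} (hr : l ≤ r)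
    {E E' : Matrix (Fin n) (Fin n) 𝒪[F]}
    (hE : redMod r (E' * E) = 1) (hβ : redMod r (E * β) = redMod r (β * E))
    (X : Matrix (Fin n) (Fin n) 𝒪[F]) :
    traceChar τ ϖ l β (E * X * E') = traceChar τ ϖ l β X := by
  obtain ⟨Z, hZ⟩ : ∃ Z, E' * (β * E) = β + ϖ ^ r • Z := by
    refine exists_eq_add_smul_of_redMod_eq hϖ ?_
    rw [map_redMod_mul, ← hβ, ← map_redMod_mul, ← mul_assoc, map_redMod_mul, hE, one_mul]
  have h1 : (E * X * E' * β).trace = (X * β).trace + ϖ ^ l * (ϖ ^ (r - l) * (X * Z).trace) := by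
    rw [mul_assoc, mul_assoc, Matrix.trace_mul_comm, mul_assoc, mul_assoc, hZ, mul_add,
      Matrix.trace_add, Matrix.mul_smul, Matrix.trace_smul, smul_eq_mul, ← mul_assoc, ← pow_add,
      Nat.add_sub_cancel' hr]
  have hϖ0 : (ϖ : F) ≠ 0 := fun h => hϖ.ne_zero (Subtype.ext h)
  rw [traceChar, traceChar, h1, Subring.coe_add, mul_add, AddChar.map_add_eq_mul, Circle.coe_mul]
  have h3 : ((ϖ : F) ^ l)⁻¹ * ((ϖ ^ l * (ϖ ^ (r - l) * (X * Z).trace) : 𝒪[F]) : F) =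
      ((ϖ ^ (r - l) * (X * Z).trace : 𝒪[F]) : F) := by
    rw [Subring.coe_mul, Subring.coe_pow, inv_mul_cancel_left₀ (pow_ne_zero _ hϖ0)]
  rw [h3, tau_integer τ hτ, Circle.coe_one, mul_one]

end Tau

/-- 𝔽[β̄] is commutative, so [X, Z] is divisible by ϖ and the commutator correction by ϖ^l. -/
lemma expKBeta_add [IsDiscreteValuationRing 𝒪[F]] (hβ : IsRegular (residueMat β))
    (X Z : Matrix (Fin n) (Fin n) 𝒪[F])
    (hX : residueMat X ∈ resAlg β) (hZ : residueMat Z ∈ resAlg β)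
    (hXZ : residueMat (X + Z) ∈ resAlg β) :
    expKBeta hϖ hh hl X hX * expKBeta hϖ hh hl Z hZ = expKBeta hϖ hh hl (X + Z) hXZ := by
  refine Subtype.ext ?_
  obtain ⟨D, hD⟩ : ∃ D, X * Z = Z * X + ϖ • D := by
    refine exists_eq_add_smul_of_residueMat_eq hϖ ?_
    rw [residueMat_mul, residueMat_mul]
    obtain ⟨p, hp⟩ := hβ.exists_aeval_eq ((mem_resAlg_iff hβ _).1 hX)
    obtain ⟨q, hq⟩ := hβ.exists_aeval_eq ((mem_resAlg_iff hβ _).1 hZ)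
    rw [← hp, ← hq, ← map_mul, mul_comm, map_mul]
  change expK hϖ hh hl X * expK hϖ hh hl Z = expK hϖ hh hl (X + Z)
  rw [expK_mul, hD, add_sub_cancel_left, smul_smul, expK_add_smul]
  obtain ⟨j, rfl⟩ : ∃ j, l = j + 1 := ⟨l - 1, by omega⟩
  exact ⟨h, by rw [Nat.add_sub_cancel, pow_succ]; ring⟩

/-- A character `Ψ` of the additive group `M_n(O)` such that `Ψ(X)` extends
`ψ(1 + ϖ^{l-1} X + ϖ^{2l-2} X² / 2)`, and which is invariant under `𝒞` up to the character
`χ(tr(X M))` of `M_n(𝔽)`. -/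
structure IsExtChar (ψ : KpredBeta ϖ hϖ l hl β →* ℂˣ) (χ : AddChar 𝓀[F] ℂ)
    (M : Matrix (Fin n) (Fin n) 𝓀[F]) (Ψ : Matrix (Fin n) (Fin n) 𝒪[F] → ℂ) : Prop where
  ne_zero (X) : Ψ X ≠ 0
  add (X Y) : Ψ (X + Y) = Ψ X * Ψ Y
  smul (X) : Ψ (ϖ ^ (l - 1) • X) = χ ((residueMat X * residueMat β).trace)
  psi (Z hZ) : ((ψ (expKBeta hϖ hh hl Z hZ) : ℂˣ) : ℂ) = Ψ Z
  conj (E E' X) (hE : redMod (2 * l - 1) (E' * E) = 1)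
    (hβ : redMod (2 * l - 1) (E * β) = redMod (2 * l - 1) (β * E)) :
    Ψ (E * X * E') = Ψ X * χ ((residueMat E * residueMat X * residueMat E' * M).trace -
      (residueMat X * M).trace)

/-- The quotient of ψ(exp Z) by the trace character is trivial on ϖ M_n(O), hence a character of
𝔽[β̄]; it extends to M_n(𝔽) as χ(tr(· M)). The trace character is 𝒞-invariant, so only M contributes
to the conjugation defect. -/
theorem exists_isExtChar [IsDiscreteValuationRing 𝒪[F]] [Finite 𝓀[F]]
    (hβ : IsRegular (residueMat β))
    (τ : AddChar F Circle) (hτ : {x : F | ∀ y : 𝒪[F], τ (x * y) = 1} = {x : F | x ∈ 𝒪[F]})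
    (ψ : KpredBeta ϖ hϖ l hl β →* ℂˣ) (hψ : ψ ∈ Y ϖ hϖ τ l hl β) :
    ∃ χ M Ψ, χ ≠ 1 ∧ IsExtChar hϖ hh hl ψ χ M Ψ := by
  obtain ⟨χ, hχ1, hχ⟩ := exists_residue_addChar τ hτ hϖ
  set A := Subalgebra.toSubmodule (Algebra.adjoin 𝓀[F] {residueMat β})
  have hz (Y : Matrix (Fin n) (Fin n) 𝒪[F]) : residueMat (ϖ • Y) ∈ resAlg β := by
    rw [residueMat_smul, residue_uniformizer hϖ, zero_smul]; exact zero_mem _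
  have hψ1 (Y : Matrix (Fin n) (Fin n) 𝒪[F]) :
      ((ψ (expKBeta hϖ hh hl (ϖ • Y) (hz Y)) : ℂˣ) : ℂ) = traceChar τ ϖ l β (ϖ • Y) := by
    have h1 := traceChar_smul (β := β) hϖ τ (m := 1) (l := l) (by omega) Y
    rw [pow_one] at h1
    rw [h1]
    refine hψ _ Y ?_
    change redMod (2 * l - 1) (expMat ϖ h l (ϖ • Y)) = _
    -- The quadratic term has order ϖ^{2l} and dies mod 𝔭^r, so exp(ϖ Y) lies in K_l, where ψ is
    -- ψ_β.
    have h3 : expMat ϖ h l (ϖ • Y) = 1 + ϖ ^ l • Y +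
        (ϖ ^ (l - 1) * ϖ ^ (l - 1) * ϖ) • ((h * ϖ) • (Y * Y)) := by
      obtain ⟨j, rfl⟩ : ∃ j, l = j + 1 := ⟨l - 1, by omega⟩
      simp only [expMat, Nat.add_sub_cancel, Matrix.smul_mul, Matrix.mul_smul, smul_smul, pow_succ]
      module
    rw [h3, redMod_add_smul hϖ (pow_dvd_pow_mul_self_mul hl dvd_rfl)]
  choose s hs using residueMat_surjective (F := F) (n := n)
  have hsA (a : A) : residueMat (s a) ∈ resAlg β := by rw [hs]; exact a.2
  let g (Z : Matrix (Fin n) (Fin n) 𝒪[F]) (hZ : residueMat Z ∈ resAlg β) : ℂ :=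
    (ψ (expKBeta hϖ hh hl Z hZ) : ℂˣ) * (traceChar τ ϖ l β Z)⁻¹
  have hg_add (X Z) (hX hZ hXZ) : g (X + Z) hXZ = g X hX * g Z hZ := by
    simp only [g]
    rw [← expKBeta_add hϖ hh hl hβ X Z hX hZ, map_mul, Units.val_mul, traceChar_add, mul_inv]
    ring
  have hg_res (X Z) (hX hZ) (hXZ : residueMat X = residueMat Z) : g X hX = g Z hZ := by
    obtain ⟨D, rfl⟩ := exists_eq_add_smul_of_residueMat_eq hϖ hXZ
    rw [hg_add _ _ hZ (hz D)]
    have : g (ϖ • D) (hz D) = 1 := by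
      simp only [g]
      rw [hψ1, mul_inv_cancel₀ (traceChar_ne_zero τ _)]
    rw [this, mul_one]
  have hadd {X Z : Matrix (Fin n) (Fin n) 𝒪[F]} (hX : residueMat X ∈ resAlg β)
      (hZ : residueMat Z ∈ resAlg β) : residueMat (X + Z) ∈ resAlg β := by
    rw [residueMat_add]; exact add_mem hX hZ
  let f : AddChar A ℂ :=
    { toFun := fun a => g (s a) (hsA a)
      map_zero_eq_one' := by
        have h0 := hg_add 0 0 (by simp) (by simp) (by simp)
        have h1 : g 0 (by simp) ≠ 0 :=
          mul_ne_zero (Units.ne_zero _) (inv_ne_zero (traceChar_ne_zero τ _))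
        have h3 : g 0 (by simp) = 1 := by
          simp only [add_zero] at h0
          exact (mul_right_cancel₀ h1 (by rw [one_mul]; exact h0)).symm
        rw [← h3]
        exact hg_res _ _ _ _ (by rw [hs]; simp)
      map_add_eq_mul' := fun a b => by
        rw [← hg_add _ _ _ _ (hadd (hsA a) (hsA b))]
        exact hg_res _ _ _ _ (by rw [hs, residueMat_add, hs, hs]; rfl) }
  obtain ⟨φ, hφ⟩ := exists_linearMap_of_addChar χ hχ1 A f
  obtain ⟨M, hM⟩ := exists_trace_mul_eq φ
  refine ⟨χ, M, fun X => traceChar τ ϖ l β X * χ ((residueMat X * M).trace), hχ1,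
    fun X => mul_ne_zero (traceChar_ne_zero τ _) (AddChar.val_isUnit χ _).ne_zero,
    fun X Y => ?_, fun X => ?_, fun Z hZ => ?_, fun E E' X hE hβE => ?_⟩
  · rw [traceChar_add, residueMat_add, add_mul, Matrix.trace_add, AddChar.map_add_eq_mul]; ring
  · rw [traceChar_smul hϖ τ (by omega), residueMat_smul, map_pow, residue_uniformizer hϖ,
      zero_pow (by omega), zero_smul, zero_mul, Matrix.trace_zero, AddChar.map_zero_eq_one, mul_one,
      ← residueMat_mul, trace_residueMat, hχ]
    congr 3
    have : l - (l - 1) = 1 := by omega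
    rw [this, pow_one]
  · have h1 := hφ ⟨residueMat Z, hZ⟩
    rw [hM] at h1
    have h3 : f ⟨residueMat Z, hZ⟩ = g Z hZ := hg_res _ _ _ _ (hs _)
    rw [h3] at h1
    change _ = _ * χ ((residueMat Z * M).trace)
    rw [← h1]
    simp only [g]
    rw [mul_left_comm, mul_inv_cancel₀ (traceChar_ne_zero τ _), mul_one]
  · rw [traceChar_conj hϖ τ hτ (r := 2 * l - 1) (by omega) hE hβE,
      residueMat_mul, residueMat_mul, mul_assoc (traceChar τ ϖ l β X), ← AddChar.map_add_eq_mul,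
      add_sub_cancel]

end Extension

/-! ### From π_ψ to a Weyl system, and lifts of elements of 𝒞 -/

section SchurMultiplier

open Polynomial

variable {F : Type*} [Field F] [ValuativeRel F] {n : ℕ}
variable {ϖ h : 𝒪[F]} {hϖ : Irreducible ϖ} {hh : 2 * h = 1} {l : ℕ} {hl : 2 ≤ l}
  {β : Matrix (Fin n) (Fin n) 𝒪[F]}
  {ψ : KpredBeta ϖ hϖ l hl β →* ℂˣ} {χ : AddChar 𝓀[F] ℂ}
  {M : Matrix (Fin n) (Fin n) 𝓀[F]} {Ψ : Matrix (Fin n) (Fin n) 𝒪[F] → ℂ}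

/-- Conjugation in exponential coordinates adds the commutator once; the next terms have order
ϖ^{2l-2} in the argument, which is at least ϖ^l. -/
lemma expK_mul_comm (X Z : Matrix (Fin n) (Fin n) 𝒪[F]) :
    expK hϖ hh hl Z * expK hϖ hh hl X =
      expK hϖ hh hl X * expK hϖ hh hl (Z + ϖ ^ (l - 1) • (Z * X - X * Z)) := by
  rw [expK_mul, expK_mul]
  have hd : ϖ ^ l ∣ h * (ϖ ^ (l - 1) * ϖ ^ (l - 1)) := by
    rw [← pow_add]; exact Dvd.dvd.mul_left (pow_dvd_pow _ (by omega)) _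
  rw [← expK_add_smul hϖ hh hl hd _ (X * (Z * X - X * Z) - (Z * X - X * Z) * X)]
  congr 1
  generalize ϖ ^ (l - 1) = a
  simp only [mul_add, add_mul, mul_sub, sub_mul, Matrix.smul_mul, Matrix.mul_smul,
    smul_add, smul_sub, smul_smul, mul_assoc]
  match_scalars <;> first | ring1 | linear_combination a * hh | linear_combination (-a) * hh

namespace IsExtChar

variable (hΨ : IsExtChar hϖ hh hl ψ χ M Ψ)
include hΨ

/-- Z̄ lies in the radical of ω. Together with `expK_mul_comm` this makes ψ stable under K_{l-1}. -/
lemma add_pow_smul (hβ : IsRegular (residueMat β)) {Z : Matrix (Fin n) (Fin n) 𝒪[F]}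
    (hZ : residueMat Z ∈ resAlg β) (X : Matrix (Fin n) (Fin n) 𝒪[F]) :
    Ψ (Z + ϖ ^ (l - 1) • (Z * X - X * Z)) = Ψ Z := by
  have h1 : ((residueMat (Z * X - X * Z)) * residueMat β).trace = 0 := by
    rw [residueMat_sub, residueMat_mul, residueMat_mul]
    change comForm (residueMat β) (residueMat Z) (residueMat X) = 0
    rw [comForm_swap, comForm_eq, ((mem_resAlg_iff hβ _).1 hZ).eq, sub_self, mul_zero,
      Matrix.trace_zero, neg_zero]
  rw [hΨ.add, hΨ.smul, h1, AddChar.map_zero_eq_one, mul_one]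

variable {H : Type*} [AddCommGroup H] [Module ℂ H] (π : Representation ℂ (Kpred F n l) H)

lemma eigenspace_invariant [IsDiscreteValuationRing 𝒪[F]] (hβ : IsRegular (residueMat β)) {v : H}
    (hv : ∀ z : KpredBeta ϖ hϖ l hl β, π z v = ((ψ z : ℂˣ) : ℂ) • v) (g : Kpred F n l)
    (z : KpredBeta ϖ hϖ l hl β) : π z (π g v) = ((ψ z : ℂˣ) : ℂ) • π g v := by
  obtain ⟨X, rfl⟩ := exists_expK_eq hϖ hh hl g
  obtain ⟨Z, hZ, rfl⟩ := exists_expKBeta_eq hϖ hh hl z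
  have hZ' : residueMat (Z + ϖ ^ (l - 1) • (Z * X - X * Z)) ∈ resAlg β := by
    rwa [residueMat_add, residueMat_smul, map_pow, residue_uniformizer hϖ, zero_pow (by omega),
      zero_smul, add_zero]
  have h1 := hv (expKBeta hϖ hh hl _ hZ')
  rw [hΨ.psi, hΨ.add_pow_smul hβ hZ] at h1
  change π (expK hϖ hh hl _) v = _ at h1
  change π (expK hϖ hh hl Z) _ = _
  rw [hΨ.psi, ← Module.End.mul_apply, ← map_mul, expK_mul_comm, map_mul, Module.End.mul_apply, h1,
    map_smul]

variable {π}

/-- As ψ is stable under K_{l-1}, its eigenspace is a subrepresentation, hence everything. -/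
lemma apply_eq_smul [IsDiscreteValuationRing 𝒪[F]] (hβ : IsRegular (residueMat β))
    (hπ : π.IsIrreducible) {v : H} (hv0 : v ≠ 0)
    (hv : ∀ z : KpredBeta ϖ hϖ l hl β, π z v = ((ψ z : ℂˣ) : ℂ) • v)
    (z : KpredBeta ϖ hϖ l hl β) : π z = ((ψ z : ℂˣ) : ℂ) • 1 := by
  let p : Submodule ℂ H := ⨅ z : KpredBeta ϖ hϖ l hl β,
    Module.End.eigenspace (π z) ((ψ z : ℂˣ) : ℂ)
  have hp {w : H} : w ∈ p ↔ ∀ z : KpredBeta ϖ hϖ l hl β, π z w = ((ψ z : ℂˣ) : ℂ) • w := by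
    simp [p, Submodule.mem_iInf]
  have htop : p = ⊤ := by
    refine (((isIrreducible_iff π).1 hπ).2 p fun g w hw => ?_).resolve_left fun h => hv0 ?_
    · exact hp.2 (hΨ.eigenspace_invariant π hβ (hp.1 hw) g)
    · exact (Submodule.mem_bot ℂ).1 (h ▸ hp.2 hv)
  ext w
  exact hp.1 (htop ▸ Submodule.mem_top) z

/-- Dividing π(exp X) by Ψ(X) leaves an operator depending only on X̄, because exp(ϖ D) acts by the
scalar Ψ(ϖ D). The commutator term of exp X · exp Y then becomes the Weyl phase through the values
of Ψ on ϖ^{l-1} M_n(O). -/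
theorem exists_isWeylSystem [IsDiscreteValuationRing 𝒪[F]] (hβ : IsRegular (residueMat β))
    (hπ : π.IsIrreducible)
    (hψ : ∀ z : KpredBeta ϖ hϖ l hl β, π z = ((ψ z : ℂˣ) : ℂ) • 1) :
    ∃ W, IsWeylSystem χ (residueMat β) W ∧
      ∀ X, π (expK hϖ hh hl X) = Ψ X • W (residueMat X) := by
  choose s hs using residueMat_surjective (F := F) (n := n)
  let W (x) : Module.End ℂ H := (Ψ (s x))⁻¹ • π (expK hϖ hh hl (s x))
  have hz (Y : Matrix (Fin n) (Fin n) 𝒪[F]) : residueMat (ϖ • Y) ∈ resAlg β := by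
    rw [residueMat_smul, residue_uniformizer hϖ, zero_smul]; exact zero_mem _
  have hZ {Z} (hZ : residueMat Z ∈ resAlg β) : π (expK hϖ hh hl Z) = Ψ Z • 1 := by
    rw [← hΨ.psi Z hZ]; exact hψ (expKBeta hϖ hh hl Z hZ)
  have hdvd : ϖ ^ l ∣ h * ϖ ^ (l - 1) * ϖ := by
    obtain ⟨j, rfl⟩ : ∃ j, l = j + 1 := ⟨l - 1, by omega⟩
    exact ⟨h, by rw [Nat.add_sub_cancel, pow_succ]; ring⟩
  have hW (X) : π (expK hϖ hh hl X) = Ψ X • W (residueMat X) := by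
    obtain ⟨D, hD⟩ := exists_eq_add_smul_of_residueMat_eq hϖ (hs (residueMat X)).symm
    have h1 : expK hϖ hh hl X =
        expK hϖ hh hl (s (residueMat X)) * expK hϖ hh hl (ϖ • D) := by
      rw [expK_mul, ← hD, Matrix.mul_smul, Matrix.smul_mul, ← smul_sub, smul_smul,
        expK_add_smul hϖ hh hl hdvd]
    have h3 : Ψ X = Ψ (s (residueMat X)) * Ψ (ϖ • D) := by rw [← hΨ.add, ← hD]
    simp only [W]
    rw [h1, map_mul, hZ (hz D), h3, smul_smul, mul_smul_comm, mul_one, mul_comm (Ψ (s _)),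
      mul_assoc, mul_inv_cancel₀ (hΨ.ne_zero _), mul_one]
  have hW' (X) : W (residueMat X) = (Ψ X)⁻¹ • π (expK hϖ hh hl X) := by
    rw [hW, inv_smul_smul₀ (hΨ.ne_zero _)]
  have h2 : IsLocalRing.residue 𝒪[F] h = 2⁻¹ := by
    have := congrArg (IsLocalRing.residue 𝒪[F]) hh
    rw [map_mul, map_ofNat, map_one] at this
    exact eq_inv_of_mul_eq_one_right this
  refine ⟨W, ⟨fun x y => ?_, fun x hx => ?_, fun p hp => ?_⟩, hW⟩
  · obtain ⟨X, rfl⟩ := residueMat_surjective x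
    obtain ⟨Y, rfl⟩ := residueMat_surjective y
    have h1 : (h * ϖ ^ (l - 1)) • (X * Y - Y * X) =
        ϖ ^ (l - 1) • (h • (X * Y - Y * X)) := by rw [smul_smul, mul_comm]
    have h3 : residueMat (X + Y + (h * ϖ ^ (l - 1)) • (X * Y - Y * X)) =
        residueMat X + residueMat Y := by
      rw [residueMat_add, residueMat_add, residueMat_smul, map_mul, map_pow,
        residue_uniformizer hϖ, zero_pow (by omega), mul_zero, zero_smul, add_zero]
    rw [hW' X, hW' Y, smul_mul_smul_comm, ← map_mul, expK_mul, hW, h3, h1, hΨ.add, hΨ.smul, hΨ.add,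
      smul_smul, residueMat_smul, h2, Matrix.smul_mul, Matrix.trace_smul, residueMat_sub,
      residueMat_mul, residueMat_mul, smul_eq_mul]
    congr 1
    have := hΨ.ne_zero X
    have := hΨ.ne_zero Y
    rw [← mul_assoc, ← mul_inv, inv_mul_cancel₀ (mul_ne_zero ‹_› ‹_›), one_mul]
    rfl
  · obtain ⟨X, rfl⟩ := residueMat_surjective x
    rw [hW', hZ ((mem_resAlg_iff hβ _).2 hx), inv_smul_smul₀ (hΨ.ne_zero _)]
  · refine ((isIrreducible_iff π).1 hπ).2 p fun g v hv => ?_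
    obtain ⟨X, rfl⟩ := exists_expK_eq hϖ hh hl g
    rw [hW]
    exact p.smul_mem _ (hp _ v hv)

end IsExtChar

lemma exists_aeval_eq_of_mem_adjoin {R A : Type*} [CommRing R] [Ring A] [Algebra R A] {a x : A}
    (hx : x ∈ Algebra.adjoin R {a}) : ∃ p : R[X], aeval a p = x := by
  rwa [Algebra.adjoin_singleton_eq_range_aeval] at hx

lemma commute_of_mem_adjoin_singleton {R A : Type*} [CommRing R] [Ring A] [Algebra R A]
    {a x y : A} (hx : x ∈ Algebra.adjoin R {a}) (hy : y ∈ Algebra.adjoin R {a}) : Commute x y := by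
  obtain ⟨p, rfl⟩ := exists_aeval_eq_of_mem_adjoin hx
  obtain ⟨q, rfl⟩ := exists_aeval_eq_of_mem_adjoin hy
  exact (Commute.all p q).map (aeval a)

/-- Lifts to `M_n(O)` of an element of `𝒞` and of its inverse. -/
lemma exists_lift_of_mem_C [IsDiscreteValuationRing 𝒪[F]] (hl : 2 ≤ l)
    (hβ : IsRegular (residueMat β)) (ε : C (2 * l - 1) β) :
    ∃ E E' : Matrix (Fin n) (Fin n) 𝒪[F], redMod (2 * l - 1) E = (ε : G F n (2 * l - 1)) ∧
      redMod (2 * l - 1) E' = ((ε : G F n (2 * l - 1))⁻¹ : G F n (2 * l - 1)) ∧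
      redMod (2 * l - 1) (E' * E) = 1 ∧
      redMod (2 * l - 1) (E * β) = redMod (2 * l - 1) (β * E) ∧
      residueMat E * residueMat E' = 1 ∧
      (∃ p : 𝓀[F][X], aeval (residueMat β) p = residueMat E) ∧
      ∃ p : 𝓀[F][X], aeval (residueMat β) p = residueMat E' := by
  obtain ⟨ε, u, hu⟩ := ε
  have hcomm (x : Algebra.adjoin (ResRing F (2 * l - 1)) {redMod (2 * l - 1) β}) :
      (x : Matrix (Fin n) (Fin n) (ResRing F (2 * l - 1))) * redMod (2 * l - 1) β =
        redMod (2 * l - 1) β * x :=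
    commute_of_mem_adjoin_singleton x.2 (Algebra.self_mem_adjoin_singleton _ _)
  have h1 : ((u : Algebra.adjoin (ResRing F (2 * l - 1)) {redMod (2 * l - 1) β}) :
      Matrix (Fin n) (Fin n) (ResRing F (2 * l - 1))) = ε := congrArg Units.val hu
  have h3 : (((u⁻¹ : (Algebra.adjoin (ResRing F (2 * l - 1)) {redMod (2 * l - 1) β})ˣ) :
      Algebra.adjoin (ResRing F (2 * l - 1)) {redMod (2 * l - 1) β}) :
      Matrix (Fin n) (Fin n) (ResRing F (2 * l - 1))) = (ε⁻¹ : G F n (2 * l - 1)) := by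
    rw [← hu, ← map_inv]; rfl
  obtain ⟨E, hE⟩ := exists_redMod (ε : Matrix (Fin n) (Fin n) (ResRing F (2 * l - 1)))
  obtain ⟨E', hE'⟩ := exists_redMod ((ε⁻¹ : G F n (2 * l - 1)) :
    Matrix (Fin n) (Fin n) (ResRing F (2 * l - 1)))
  have hr : 0 < 2 * l - 1 := by omega
  have h4 : redMod (2 * l - 1) (E * β) = redMod (2 * l - 1) (β * E) := by
    rw [map_redMod_mul, map_redMod_mul, hE, ← h1, hcomm]
  have h5 : redMod (2 * l - 1) (E' * β) = redMod (2 * l - 1) (β * E') := by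
    rw [map_redMod_mul, map_redMod_mul, hE', ← h3, hcomm]
  refine ⟨E, E', hE, hE', by rw [map_redMod_mul, hE, hE', Units.inv_mul], h4, ?_, ?_, ?_⟩
  · rw [← residueMat_mul, ← residueMat_one]
    refine residueMat_eq_of_redMod_eq hr ?_
    rw [map_redMod_mul, hE, hE', Units.mul_inv, redMod_one]
  · refine hβ.exists_aeval_eq ?_
    have := residueMat_eq_of_redMod_eq hr h4
    rwa [residueMat_mul, residueMat_mul] at this
  · refine hβ.exists_aeval_eq ?_
    have := residueMat_eq_of_redMod_eq hr h5
    rwa [residueMat_mul, residueMat_mul] at this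

lemma C_mul_comm (ε η : C (2 * l - 1) β) : ε * η = η * ε := by
  obtain ⟨_, u, rfl⟩ := ε
  obtain ⟨_, v, rfl⟩ := η
  refine Subtype.ext ?_
  change Units.map _ u * Units.map _ v = Units.map _ v * Units.map _ u
  rw [← map_mul, ← map_mul]
  congr 1
  exact Units.ext (Subtype.ext (commute_of_mem_adjoin_singleton (Subtype.prop _) (Subtype.prop _)))

instance finite_resRing [IsDiscreteValuationRing 𝒪[F]] [Finite 𝓀[F]] (r : ℕ) :
    Finite (ResRing F r) :=
  have : Finite (𝒪[F] ⧸ 𝓂[F]) := ‹Finite 𝓀[F]›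
  Ideal.finite_quotient_pow (IsNoetherian.noetherian _) r

lemma finiteDimensional_of_isIrreducible {Γ H : Type*} [Group Γ] [Finite Γ] [AddCommGroup H]
    [Module ℂ H] {π : Representation ℂ Γ H} (hπ : π.IsIrreducible) : FiniteDimensional ℂ H := by
  obtain ⟨hH, hirr⟩ := (isIrreducible_iff π).1 hπ
  obtain ⟨v, hv⟩ := exists_ne (0 : H)
  have h1 : Submodule.span ℂ (Set.range fun g => π g v) = ⊤ := by
    refine (hirr _ fun g w hw => ?_).resolve_left fun h => hv ?_
    · induction hw using Submodule.span_induction with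
      | mem x hx =>
        obtain ⟨k, rfl⟩ := hx
        refine Submodule.subset_span ⟨g * k, ?_⟩
        simp
      | zero => rw [map_zero]; exact zero_mem _
      | add x y _ _ hx hy => rw [map_add]; exact add_mem hx hy
      | smul c x _ hx => rw [map_smul]; exact Submodule.smul_mem _ _ hx
    · refine (Submodule.mem_bot ℂ).1 (h ▸ Submodule.subset_span ⟨1, ?_⟩)
      simp
  exact ⟨h1 ▸ Submodule.fg_span (Set.finite_range _)⟩

end SchurMultiplier

/-! ### Triviality and existence of the Schur multiplier -/

section SchurMultiplier

open Polynomial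

variable {F : Type*} [Field F] [ValuativeRel F] {n : ℕ}
variable {ϖ h : 𝒪[F]} {hϖ : Irreducible ϖ} {hh : 2 * h = 1} {l : ℕ} {hl : 2 ≤ l}
  {β : Matrix (Fin n) (Fin n) 𝒪[F]}
  {ψ : KpredBeta ϖ hϖ l hl β →* ℂˣ} {χ : AddChar 𝓀[F] ℂ}
  {M : Matrix (Fin n) (Fin n) 𝓀[F]} {Ψ : Matrix (Fin n) (Fin n) 𝒪[F] → ℂ}

lemma IsPiPsi.exists_eigenvector {H : Type} [AddCommGroup H] [Module ℂ H]
    {π : Representation ℂ (Kpred F n l) H} (hπ : IsPiPsi ψ π) :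
    ∃ v ≠ 0, ∀ z : KpredBeta ϖ hϖ l hl β, π z v = ((ψ z : ℂˣ) : ℂ) • v := by
  have := Module.nontrivial_of_finrank_pos hπ.2
  obtain ⟨f, hf⟩ := exists_ne (0 : (charRep ψ).IntertwiningMap
    (π.comp (KpredBeta ϖ hϖ l hl β).subtype))
  have hmul (c : ℂ) : f c = c • f 1 := by rw [← map_smul, smul_eq_mul, mul_one]
  refine ⟨f 1, fun h => hf ?_, fun z => ?_⟩
  · refine Representation.IntertwiningMap.ext (LinearMap.ext fun c => ?_)
    exact (hmul c).trans (by rw [h, smul_zero]; rfl)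
  · have h1 := Representation.IntertwiningMap.isIntertwining _ _ f z 1
    rw [← hmul]
    refine h1.symm.trans (congrArg f ?_)
    simp [charRep]

lemma isPiPsi_of_apply_eq_smul {H : Type} [AddCommGroup H] [Module ℂ H] [FiniteDimensional ℂ H]
    {π : Representation ℂ (Kpred F n l) H} (hπ : π.IsIrreducible)
    (h : ∀ z : KpredBeta ϖ hϖ l hl β, π z = ((ψ z : ℂˣ) : ℂ) • 1) : IsPiPsi ψ π := by
  refine ⟨hπ, ?_⟩
  have hH := ((isIrreducible_iff π).1 hπ).1
  obtain ⟨v, hv⟩ := exists_ne (0 : H)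
  let toLin : (charRep ψ).IntertwiningMap (π.comp (KpredBeta ϖ hϖ l hl β).subtype) →ₗ[ℂ]
      (ℂ →ₗ[ℂ] H) :=
    { toFun := fun f => f.toLinearMap
      map_add' := fun _ _ => rfl
      map_smul' := fun _ _ => rfl }
  -- `finrank` is zero on infinite-dimensional spaces, so positivity needs finiteness as well as a
  -- nonzero map.
  have : Module.Finite ℂ ((charRep ψ).IntertwiningMap
      (π.comp (KpredBeta ϖ hϖ l hl β).subtype)) :=
    Module.Finite.of_injective toLin fun f g hfg => Representation.IntertwiningMap.ext hfg
  let f : (charRep ψ).IntertwiningMap (π.comp (KpredBeta ϖ hϖ l hl β).subtype) :=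
    ⟨LinearMap.toSpanSingleton ℂ H v, fun z => LinearMap.ext fun c => by
      change ((ψ z : ℂˣ) * c : ℂ) • v = π z (c • v)
      rw [h z, LinearMap.smul_apply, Module.End.one_apply, smul_smul]⟩
  have hf : f ≠ 0 := fun h0 => hv (by
    have := congrArg (fun g => g.toLinearMap 1) h0
    simpa [f] using this)
  have : Nontrivial ((charRep ψ).IntertwiningMap
      (π.comp (KpredBeta ϖ hϖ l hl β).subtype)) := ⟨f, 0, hf⟩
  exact Module.finrank_pos

lemma two_ne_zero_of_mul_eq_one (hh : 2 * h = 1) : (2 : 𝓀[F]) ≠ 0 := by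
  intro h2
  have := congrArg (IsLocalRing.residue 𝒪[F]) hh
  rw [map_mul, map_ofNat, map_one, h2, zero_mul] at this
  exact zero_ne_one this

section

variable [IsDiscreteValuationRing 𝒪[F]] [Finite 𝓀[F]]

theorem IsExtChar.eq_one (hΨ : IsExtChar hϖ hh hl ψ χ M Ψ) (hβ : IsRegular (residueMat β))
    (hχ : χ ≠ 1) {c : H2 (C (2 * l - 1) β) ℂˣ} (hc : IsSchurMultiplier ψ c) : c = 1 := by
  obtain ⟨H, _, _, π, U, cU, hπ, hU, hcU, rfl⟩ := hc
  have := Fintype.ofFinite 𝓀[F]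
  have := finiteDimensional_of_isIrreducible hπ.1
  have := ((isIrreducible_iff π).1 hπ.1).1
  obtain ⟨v, hv0, hv⟩ := hπ.exists_eigenvector
  obtain ⟨W, hW, hπW⟩ := hΨ.exists_isWeylSystem hβ hπ.1 (hΨ.apply_eq_smul hβ hπ.1 hv0 hv)
  have h2 := two_ne_zero_of_mul_eq_one hh
  have hUW (ε : C (2 * l - 1) β) {E E'}
      (hE : redMod (2 * l - 1) E = (ε : G F n (2 * l - 1)))
      (hE' : redMod (2 * l - 1) E' = ((ε : G F n (2 * l - 1))⁻¹ : G F n (2 * l - 1)))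
      (hEE : redMod (2 * l - 1) (E' * E) = 1)
      (hEβ : redMod (2 * l - 1) (E * β) = redMod (2 * l - 1) (β * E)) (x) :
      (U ε : Module.End ℂ H) * W x =
        χ ((residueMat E * x * residueMat E' * M).trace - (x * M).trace) •
          (W (residueMat E * x * residueMat E') * U ε) := by
    obtain ⟨X, rfl⟩ := residueMat_surjective x
    have h1 := hU ε (expK hϖ hh hl X)
    rw [conj_expK hϖ hh hl _ hE hE', hπW, hπW, hΨ.conj E E' X hEE hEβ, residueMat_mul,
      residueMat_mul, mul_smul, mul_smul_comm, smul_mul_assoc] at h1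
    have h3 := smul_right_injective _ (hΨ.ne_zero X) h1
    have h4 := congrArg (· * (U ε : Module.End ℂ H)) h3
    simp only [mul_assoc, Units.inv_mul, mul_one, smul_mul_assoc] at h4
    rw [← h4]
    simp only [mul_assoc]
  refine mk_eq_one_of_commute U cU hcU fun ε η => ?_
  obtain ⟨E, E', hE, hE', hEE, hEβ, hres, ⟨p, hp⟩, ⟨p', hp'⟩⟩ := exists_lift_of_mem_C hl hβ ε
  obtain ⟨D, D', hD, hD', hDD, hDβ, hDres, ⟨q, hq⟩, ⟨q', hq'⟩⟩ := exists_lift_of_mem_C hl hβ η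
  have hcomm (p : 𝓀[F][X]) : Commute (aeval (residueMat β) p) (residueMat β) := by
    simpa using (Commute.all p X).map (aeval (residueMat β))
  set a : ℂ := (((cU : C (2 * l - 1) β → C (2 * l - 1) β → ℂˣ) ε η : ℂˣ) : ℂ)
  set b : ℂ := (((cU : C (2 * l - 1) β → C (2 * l - 1) β → ℂˣ) η ε : ℂˣ) : ℂ) with hb
  have hb0 : b ≠ 0 := Units.ne_zero _
  -- Since 𝒞 is abelian, the commutator scalar is c_U(ε, η) / c_U(η, ε).
  have hab : (U ε : Module.End ℂ H) * U η = (a * b⁻¹) • ((U η : Module.End ℂ H) * U ε) := by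
    rw [hcU ε η, hcU η ε, C_mul_comm η ε, smul_smul, ← hb, inv_mul_cancel_right₀ hb0]
  have := hW.commutator_eq_one h2 hχ p q hp hq hres hDres (hp' ▸ hcomm p') (hq' ▸ hcomm q')
    (hp' ▸ hq' ▸ (Commute.all p' q').map (aeval (residueMat β))) (Units.mul_inv (U ε))
    (Units.mul_inv (U η)) (hUW ε hE hE' hEE hEβ) (hUW η hD hD' hDD hDβ) hab
  rw [hab, this, one_smul]

omit [IsDiscreteValuationRing 𝒪[F]] [Finite 𝓀[F]] in
-- `IsSchurMultiplier` asks for a space in `Type`, whereas functions on K_{l-1} live in the universe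
-- of F; coordinates bridge the gap.
lemma exists_fin_representation {Γ V : Type*} [Group Γ] [AddCommGroup V] [Module ℂ V]
    [FiniteDimensional ℂ V] {σ : Representation ℂ Γ V} (hσ : σ.IsIrreducible) :
    ∃ (d : ℕ) (π : Representation ℂ Γ (Fin d → ℂ)), π.IsIrreducible ∧
      ∀ g (c : ℂ), σ g = c • 1 → π g = c • 1 := by
  obtain ⟨hV, hirr⟩ := (isIrreducible_iff σ).1 hσ
  let e : V ≃ₗ[ℂ] (Fin (Module.finrank ℂ V) → ℂ) := (Module.finBasis ℂ V).equivFun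
  let π : Representation ℂ Γ (Fin (Module.finrank ℂ V) → ℂ) :=
    (e.conjRingEquiv : Module.End ℂ V →* Module.End ℂ _).comp σ
  have hπ (g v) : π g v = e (σ g (e.symm v)) := rfl
  refine ⟨_, π, (isIrreducible_iff π).2 ⟨e.symm.toEquiv.nontrivial, fun q hq => ?_⟩,
    fun g c hg => LinearMap.ext fun v => ?_⟩
  · have h1 := hirr (q.comap e.toLinearMap) fun g u hu => by
      have := hq g _ hu
      rw [hπ] at this
      simpa using this
    have hinj := Submodule.comap_injective_of_surjective (f := e.toLinearMap) e.surjective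
    refine h1.imp (fun h1 => hinj (h1.trans ?_)) fun h1 => hinj (h1.trans ?_)
    · exact ((LinearMap.ker_eq_bot (f := e.toLinearMap)).2 e.injective).symm
    · exact (Submodule.comap_top e.toLinearMap).symm
  · rw [hπ g v, hg]
    simp

/-- In the right regular representation the ψ-eigenspace is invariant under K_{l-1} and contains ψ
extended by zero; a minimal invariant subspace of it is the required representation. -/
theorem IsExtChar.exists_representation (hΨ : IsExtChar hϖ hh hl ψ χ M Ψ)
    (hβ : IsRegular (residueMat β)) :
    ∃ (d : ℕ) (π : Representation ℂ (Kpred F n l) (Fin d → ℂ)), π.IsIrreducible ∧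
      ∀ z : KpredBeta ϖ hϖ l hl β, π z = ((ψ z : ℂˣ) : ℂ) • 1 := by
  classical
  let ρ : Representation ℂ (Kpred F n l) (Kpred F n l → ℂ) :=
    { toFun := fun g => LinearMap.funLeft ℂ ℂ (· * g)
      map_one' := by ext; simp [LinearMap.funLeft]
      map_mul' := fun g k => by
        refine LinearMap.ext fun f => funext fun x => ?_
        change f (x * (g * k)) = f (x * g * k)
        rw [mul_assoc] }
  let p₀ : Submodule ℂ (Kpred F n l → ℂ) := ⨅ z : KpredBeta ϖ hϖ l hl β,
    Module.End.eigenspace (ρ z) ((ψ z : ℂˣ) : ℂ)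
  have hp₀ {w} : w ∈ p₀ ↔ ∀ z : KpredBeta ϖ hϖ l hl β, ρ z w = ((ψ z : ℂˣ) : ℂ) • w := by
    simp [p₀, Submodule.mem_iInf]
  let f₀ : Kpred F n l → ℂ := fun k =>
    if hk : k ∈ KpredBeta ϖ hϖ l hl β then ((ψ ⟨k, hk⟩ : ℂˣ) : ℂ) else 0
  have hf₀ : f₀ ∈ p₀ := by
    refine hp₀.2 fun z => funext fun k => ?_
    change f₀ (k * z) = (ψ z : ℂˣ) * f₀ k
    by_cases hk : k ∈ KpredBeta ϖ hϖ l hl β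
    · have hkz : k * z ∈ KpredBeta ϖ hϖ l hl β := mul_mem hk z.2
      simp only [f₀, dif_pos hk, dif_pos hkz]
      have : (⟨k * z, hkz⟩ : KpredBeta ϖ hϖ l hl β) = ⟨k, hk⟩ * z := rfl
      rw [this, map_mul, Units.val_mul, mul_comm]
    · have hkz : k * z ∉ KpredBeta ϖ hϖ l hl β := fun h => hk (by
        simpa using mul_mem h (inv_mem z.2))
      simp only [f₀, dif_neg hk, dif_neg hkz, mul_zero]
  have hne : p₀ ≠ ⊥ := by
    intro h
    have h1 := (Submodule.mem_bot ℂ).1 (h ▸ hf₀)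
    have h3 : f₀ 1 = 0 := congrFun h1 1
    simp only [f₀, dif_pos (one_mem _)] at h3
    exact Units.ne_zero _ h3
  obtain ⟨p, hpp, hp, hinv, hmin⟩ := exists_minimal_invariant (fun g => ρ g) p₀ hne
    fun g w hw => hp₀.2 (hΨ.eigenspace_invariant ρ hβ (hp₀.1 hw) g)
  let σ : Representation ℂ (Kpred F n l) p :=
    (⟨p, fun g v hv => hinv g v hv⟩ : Subrepresentation ρ).toRepresentation
  have hσ : σ.IsIrreducible := by
    refine (isIrreducible_iff σ).2 ⟨Submodule.nontrivial_iff_ne_bot.2 hp, fun q hq => ?_⟩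
    have h1 := hmin (q.map p.subtype) (Submodule.map_subtype_le _ _) fun g w hw => by
      obtain ⟨u, hu, rfl⟩ := hw
      exact ⟨σ g u, hq g u hu, rfl⟩
    have hinj := Submodule.map_injective_of_injective p.subtype_injective
    refine h1.imp (fun h1 => hinj (h1.trans (Submodule.map_bot _).symm)) fun h1 => hinj (h1.trans ?_)
    rw [Submodule.map_subtype_top]
  obtain ⟨d, π, hπ, hπσ⟩ := exists_fin_representation hσ
  have h6 (z : KpredBeta ϖ hϖ l hl β) : σ z = ((ψ z : ℂˣ) : ℂ) • 1 :=
    LinearMap.ext fun w => Subtype.ext (hp₀.1 (hpp w.2) z)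
  exact ⟨d, π, hπ, fun z => hπσ z _ (h6 z)⟩

/-- The operators U(ε) come from `exists_projective_intertwiner`. Schur's lemma makes U(ε) U(η)
proportional to U(εη), and associativity is the cocycle identity. -/
theorem IsExtChar.exists_isSchurMultiplier (hΨ : IsExtChar hϖ hh hl ψ χ M Ψ)
    (hβ : IsRegular (residueMat β)) (hχ : χ ≠ 1) :
    ∃ c : H2 (C (2 * l - 1) β) ℂˣ, IsSchurMultiplier ψ c := by
  obtain ⟨d, π, hπ, hπψ⟩ := hΨ.exists_representation hβ
  have := Fintype.ofFinite 𝓀[F]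
  have := ((isIrreducible_iff π).1 hπ).1
  obtain ⟨W, hW, hπW⟩ := hΨ.exists_isWeylSystem hβ hπ hπψ
  have h2 := two_ne_zero_of_mul_eq_one hh
  have hWπ (T : Module.End ℂ (Fin d → ℂ)) (hT : ∀ k, π k * T = T * π k) (x) :
      W x * T = T * W x := by
    obtain ⟨X, rfl⟩ := residueMat_surjective x
    have h1 := hT (expK hϖ hh hl X)
    rw [hπW, smul_mul_assoc, mul_smul_comm] at h1
    exact smul_right_injective _ (hΨ.ne_zero X) h1
  have hU (ε : C (2 * l - 1) β) : ∃ U : LinearMap.GeneralLinearGroup ℂ (Fin d → ℂ),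
      ∀ k, π (MulAut.conjNormal (ε : G F n (2 * l - 1)) k) * U = U * π k := by
    obtain ⟨E, E', hE, hE', hEE, hEβ, hres, ⟨p, hp⟩, ⟨p', hp'⟩⟩ := exists_lift_of_mem_C hl hβ ε
    have hcomm : Commute (residueMat E') (residueMat β) := by
      rw [← hp']; simpa using (Commute.all p' X).map (aeval (residueMat β))
    obtain ⟨U, U', hUU', hU'U, hUW⟩ :=
      hW.exists_projective_intertwiner (M := M) h2 hχ p hp hres hcomm
    refine ⟨⟨U, U', hUU', hU'U⟩, fun k => ?_⟩
    obtain ⟨X, rfl⟩ := exists_expK_eq hϖ hh hl k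
    rw [conj_expK hϖ hh hl _ hE hE', hπW, hπW, hΨ.conj E E' X hEE hEβ, residueMat_mul,
      residueMat_mul, mul_smul_comm]
    change _ * U = _ • (U * _)
    rw [hUW, smul_mul_assoc, mul_smul]
  choose U hU using hU
  have hU' (ε : C (2 * l - 1) β) (k) :
      π (MulAut.conjNormal (ε : G F n (2 * l - 1)) k) =
        (U ε : Module.End ℂ (Fin d → ℂ)) * π k *
          ((U ε)⁻¹ : LinearMap.GeneralLinearGroup ℂ (Fin d → ℂ)) := by
    rw [← hU, mul_assoc, Units.mul_inv, mul_one]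
  have hc (ε η : C (2 * l - 1) β) : ∃ c : ℂˣ,
      (U ε : Module.End ℂ (Fin d → ℂ)) * U η = (c : ℂ) • (U (ε * η) : Module.End ℂ (Fin d → ℂ)) := by
    set A : Module.End ℂ (Fin d → ℂ) := (U ε).val
    set B : Module.End ℂ (Fin d → ℂ) := (U η).val
    set D : Module.End ℂ (Fin d → ℂ) := (U (ε * η)).val
    set D' : Module.End ℂ (Fin d → ℂ) := (U (ε * η))⁻¹.val
    have hDD' : D * D' = 1 := Units.mul_inv _
    have hD'D : D' * D = 1 := Units.inv_mul _
    obtain ⟨c, hc⟩ := hW.exists_eq_smul_one (hWπ (D' * (A * B)) fun k => by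
      have h1 : π (MulAut.conjNormal ((ε * η : C (2 * l - 1) β) : G F n (2 * l - 1)) k) * D =
        D * π k := hU (ε * η) k
      have h3 : π (MulAut.conjNormal ((ε * η : C (2 * l - 1) β) : G F n (2 * l - 1)) k) *
          (A * B) = A * B * π k := by
        rw [Subgroup.coe_mul, map_mul, MulAut.mul_apply, ← mul_assoc, hU, mul_assoc, hU,
          mul_assoc]
      have h4 : π k * D' =
          D' * π (MulAut.conjNormal ((ε * η : C (2 * l - 1) β) : G F n (2 * l - 1)) k) := by
        calc π k * D' = D' * (D * π k) * D' := by rw [← mul_assoc, hD'D, one_mul]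
          _ = _ := by rw [← h1, mul_assoc, mul_assoc _ D, hDD', mul_one]
      rw [← mul_assoc (π k) D', h4, mul_assoc D', h3, mul_assoc D'])
    have hc' : A * B = c • D := by
      rw [← one_mul (A * B), ← hDD', mul_assoc, hc, mul_smul_comm, mul_one]
    refine ⟨Units.mk0 c ?_, hc'⟩
    rintro rfl
    rw [zero_smul] at hc'
    exact Units.ne_zero (U ε * U η) hc'
  choose c hc using hc
  have hcoc : c ∈ Z2 (C (2 * l - 1) β) ℂˣ := fun x y z => by
    have h1 : (U x : Module.End ℂ (Fin d → ℂ)) * U y * U z =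
        ((c (x * y) z * c x y : ℂˣ) : ℂ) • (U (x * y * z) : Module.End ℂ (Fin d → ℂ)) := by
      rw [hc, smul_mul_assoc, hc, smul_smul, mul_comm, Units.val_mul]
    have h3 : (U x : Module.End ℂ (Fin d → ℂ)) * U y * U z =
        ((c y z * c x (y * z) : ℂˣ) : ℂ) • (U (x * y * z) : Module.End ℂ (Fin d → ℂ)) := by
      rw [mul_assoc, hc, mul_smul_comm, hc, smul_smul, Units.val_mul, mul_assoc x]
    exact Units.ext (smul_left_injective ℂ (Units.ne_zero (U (x * y * z))) (h3.symm.trans h1))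
  exact ⟨_, _, _, _, π, U, ⟨c, hcoc⟩, isPiPsi_of_apply_eq_smul hπ hπψ, hU', hc, rfl⟩

end

/-- For regular `β̄` in odd residual characteristic all the Schur multipliers are trivial. -/
theorem schurMultipliersTrivial_of_isRegular [TopologicalSpace F] [IsNonarchimedeanLocalField F]
    (h2 : (2 : 𝓀[F]) ≠ 0) (ϖ : 𝒪[F]) (hϖ : Irreducible ϖ) (τ : AddChar F Circle)
    (hτ : {x : F | ∀ y : 𝒪[F], τ (x * y) = 1} = {x : F | x ∈ 𝒪[F]})
    (l : ℕ) (hl : 2 ≤ l) (β : Matrix (Fin n) (Fin n) 𝒪[F]) (hβ : IsRegular (residueMat β)) :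
    SchurMultipliersTrivial ϖ hϖ τ l hl β := by
  have : IsUnit (2 : 𝒪[F]) := by
    rw [← IsLocalRing.residue_ne_zero_iff_isUnit, map_ofNat]; exact h2
  obtain ⟨h, hh⟩ := isUnit_iff_exists_inv.1 this
  intro ψ hψ c
  obtain ⟨χ, M, Ψ, hχ, hΨ⟩ := exists_isExtChar hϖ hh hl hβ τ hτ ψ hψ
  refine ⟨hΨ.eq_one hβ hχ, ?_⟩
  rintro rfl
  -- Some class is a multiplier, and every multiplier is 1, so 1 is one.
  obtain ⟨c, hc⟩ := hΨ.exists_isSchurMultiplier hβ hχ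
  rwa [← hΨ.eq_one hβ hχ hc]

end SchurMultiplier

end RegularChar

end

theorem mainTheorem3 {F : Type*} [Field F] [ValuativeRel F] [TopologicalSpace F]
    [IsNonarchimedeanLocalField F]
    (ϖ : 𝒪[F]) (hϖ : Irreducible ϖ)
    (τ : AddChar F Circle) (hτ_cont : Continuous τ)
    (hτ : {x : F | ∀ y : 𝒪[F], τ (x * y) = 1} = {x : F | x ∈ 𝒪[F]})
    (n l : ℕ) (hl : 2 ≤ l) (β : Matrix (Fin n) (Fin n) 𝒪[F])
    (hreg : RegularChar.IsRegular (RegularChar.residueMat β))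
    (hsplit : (RegularChar.residueMat β).charpoly.Splits)
    (f : ℕ) (m : Fin f → ℕ) (a : Fin f → 𝓀[F])
    (hJordan : RegularChar.HasJordanForm (RegularChar.residueMat β) m a)
    (hm : ∀ i, m i ≤ 4) (hchar : 7 < ringChar 𝓀[F]) :
    RegularChar.SchurMultipliersTrivial ϖ hϖ τ l hl β := by
  refine RegularChar.schurMultipliersTrivial_of_isRegular (fun h2 => ?_) ϖ hϖ τ hτ l hl β hreg
  -- The bound on the characteristic enters through 2 ≠ 0 in 𝔽.
  have h := Nat.le_of_dvd Nat.two_pos (ringChar.dvd (R := 𝓀[F]) (x := 2) (by exact_mod_cast h2))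
  omega
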